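/- **Theorem.** Let $\ell>0$ and let $f\in W^{1,2}(0,\ell)$ be a complex-valued function, identified with its absolutely continuous representative on $[0,\ell]$, such that $f(x)\neq 0$ for all $x\in[0,\ell]$. For $\rho\in\mathbb C$ let $\widehat e_f(\rho,\cdot)\in W^{2,2}(0,\ell)$ be the solution of $$-\frac1{f^2}\bigl(f^2v'\bigr)'=\rho^2 v \ \text{ on } (0,\ell),\qquad v(0)=1,\quad v'(0)=i\rho .$$ Let $\mathcal T_\ell=\{(x,t)\in\mathbb R^2: 0<x<\ell,\ |t|<x\}$. An impedance kernel of $f$ is a function $\widehat K_f\in L^2(\mathcal T_\ell)$ such that, for every $\rho\in\mathbb C$ and almost every $x\in(0,\ell)$, $$\widehat e_f(\rho,x)=e^{i\rho x}-i\rho\int_{-x}^{x}\widehat K_f(x,t)\,e^{i\rho t}\,dt .$$ Then: 1. The impedance kernel $\widehat K_f$ exists and is unique up to equality almost everywhere in $\mathcal T_\ell$. 2. $\widehat K_f\in C(\overline{\mathcal T_\ell})\cap W^{1,2}(\mathcal T_\ell)$; that is, $\widehat K_f$ agrees almost everywhere with a function that is continuous on the closed triangle $\overline{\mathcal T_\ell}$,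 and its weak partial derivatives belong to $L^2(\mathcal T_\ell)$. 3. If moreover $f$ is normalized by $f(0)=1$, then the kernels $\widehat K_f$ and $\widehat K_{1/f}$ of $f$ and $1/f$ satisfy, in the sense of weak derivatives and almost everywhere in $\mathcal T_\ell$, $$\frac{\partial \widehat K_{1/f}(x,t)}{\partial x}=-f^2(x)\,\frac{\partial \widehat K_f(x,t)}{\partial t}\qquad\text{and}\qquad \frac{\partial \widehat K_f(x,t)}{\partial x}=-\frac1{f^2(x)}\,\frac{\partial \widehat K_{1/f}(x,t)}{\partial t}.$$ -/

import Mathlib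

open MeasureTheory Set
open scoped ContDiff

noncomputable section

namespace Impedance

/-! ### Sobolev functions on the interval `(0, ℓ)` -/

/-- `u` is the absolutely continuous representative on `[0, ℓ]` of a function in `W^{1,2}(0, ℓ)`,
and its weak derivative is `g ∈ L²(0, ℓ)`. Only the values of `u` on `[0, ℓ]` matter. -/
def HasSobolevDeriv (ℓ : ℝ) (u g : ℝ → ℂ) : Prop :=
  MemLp g 2 (volume.restrict (Ioo 0 ℓ)) ∧ ∀ x ∈ Icc 0 ℓ, u x = u 0 + ∫ s in (0 : ℝ)..x, g s

/-- `u ∈ W^{1,2}(0, ℓ)`: `u` is absolutely continuous on `[0, ℓ]` with derivative in `L²`. -/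
def MemSobolevInterval (ℓ : ℝ) (u : ℝ → ℂ) : Prop :=
  ∃ g : ℝ → ℂ, HasSobolevDeriv ℓ u g

/-! ### The impedance equation -/

/-- `v` is the solution `ê_f(ρ, ·) ∈ W^{2,2}(0, ℓ)` of `-(1/f²) (f² v')' = ρ² v` with
`v(0) = 1` and `v'(0) = iρ`. Here `v₁` is the continuous derivative `v'`, `v₂ = v''` is the weak
second derivative, and `w = (f² v')'`. -/
def IsImpedanceExp (ℓ : ℝ) (f : ℝ → ℂ) (ρ : ℂ) (v : ℝ → ℂ) : Prop :=
  ∃ v₁ v₂ w : ℝ → ℂ,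
    HasSobolevDeriv ℓ v v₁ ∧
    HasSobolevDeriv ℓ v₁ v₂ ∧
    HasSobolevDeriv ℓ (fun x => f x ^ 2 * v₁ x) w ∧
    (∀ᵐ x ∂(volume.restrict (Ioo 0 ℓ)), -(1 / f x ^ 2) * w x = ρ ^ 2 * v x) ∧
    v 0 = 1 ∧ v₁ 0 = Complex.I * ρ

/-! ### The triangle and the transmutation kernel -/

/-- The open triangle; a point `p` is `(x, t)`. -/
def triangle (ℓ : ℝ) : Set (ℝ × ℝ) :=
  {p | 0 < p.1 ∧ p.1 < ℓ ∧ |p.2| < p.1}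

/-- The closed triangle `0 ≤ x ≤ ℓ`, `|t| ≤ x`. -/
def closedTriangle (ℓ : ℝ) : Set (ℝ × ℝ) :=
  {p | 0 ≤ p.1 ∧ p.1 ≤ ℓ ∧ |p.2| ≤ p.1}

/-- `K` is (a representative of) the transmutation kernel `K̂_f` of the impedance `f`:
`K ∈ L²` on the triangle and
`ê_f(ρ, x) = e^{iρx} - iρ ∫_{-x}^{x} K(x, t) e^{iρt} dt` for every `ρ ∈ ℂ`. Since `K` is an `L²`
function on the triangle, the identity is required for almost every `x`. -/
def IsImpedanceKernel (ℓ : ℝ) (f : ℝ → ℂ) (K : ℝ × ℝ → ℂ) : Prop :=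
  MemLp K 2 (volume.restrict (triangle ℓ)) ∧
  ∀ ρ : ℂ, ∃ v : ℝ → ℂ, IsImpedanceExp ℓ f ρ v ∧
    ∀ᵐ x ∂(volume.restrict (Ioo 0 ℓ)),
      v x = Complex.exp (Complex.I * ρ * x) -
        Complex.I * ρ * ∫ t in (-x)..x, K (x, t) * Complex.exp (Complex.I * ρ * t)

/-! ### Weak partial derivatives in the plane -/

/-- `g ∈ L²(Ω)` is the weak derivative of `u` on `Ω` in the direction `e`. -/
def HasWeakDirDeriv (Ω : Set (ℝ × ℝ)) (e : ℝ × ℝ) (u g : ℝ × ℝ → ℂ) : Prop :=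
  MemLp g 2 (volume.restrict Ω) ∧
  ∀ φ : ℝ × ℝ → ℂ, ContDiff ℝ ∞ φ → HasCompactSupport φ → tsupport φ ⊆ Ω →
    ∫ p in Ω, u p * fderiv ℝ φ p e = -∫ p in Ω, g p * φ p

/-- `g = ∂u/∂x ∈ L²(Ω)` weakly, where points are `(x, t)`. -/
def HasWeakDerivX (Ω : Set (ℝ × ℝ)) (u g : ℝ × ℝ → ℂ) : Prop :=
  HasWeakDirDeriv Ω (1, 0) u g

/-- `g = ∂u/∂t ∈ L²(Ω)` weakly, where points are `(x, t)`. -/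
def HasWeakDerivT (Ω : Set (ℝ × ℝ)) (u g : ℝ × ℝ → ℂ) : Prop :=
  HasWeakDirDeriv Ω (0, 1) u g

/-- `u ∈ W^{1,2}(Ω)` for an open set `Ω` of the plane. -/
def MemSobolevPlane (Ω : Set (ℝ × ℝ)) (u : ℝ × ℝ → ℂ) : Prop :=
  MemLp u 2 (volume.restrict Ω) ∧ (∃ g, HasWeakDerivX Ω u g) ∧ (∃ g, HasWeakDerivT Ω u g)

end Impedance

end

/-!
The proof reduces the impedance equation to a Goursat problem for a pair of kernels.

Let `κ = f' / f ∈ L²(0, ℓ)`. With `v = ê_f(ρ, ·)` and `u = f² v' / (iρ)`, the functions `f v` and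
`u / f` are multiples of the sum `S` and the difference `D` of two waves that solve the Dirac system
`S' = iρ D + κ S`, `D' = iρ S - κ D`. The right-going wave is `e^{iρx} + ∫ a e^{iρt} dt` and the
left-going wave is `∫ b e^{iρt} dt`, with integrals over `|t| < x` and with kernels `a`, `b` that do
not depend on `ρ`. In the characteristic coordinates `ξ = (x + t) / 2` and `η = (x - t) / 2` the
system says that `∂ₓ a = κ b` along `η = const` with `a = 0` at `t = -x`, and `∂ₓ b = κ a` along
`ξ = const` with `b = κ(ξ) / 2` at `t = x`. After the singular part `κ(ξ) / 2` of `b` is split off,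
the remaining unknowns are continuous, and they are found by the contraction principle for a
Volterra operator in an exponentially weighted sup norm (`exists_isGoursatPair`). Fubini's theorem
on the triangle turns the Goursat equations into the Dirac system (`IsGoursatPair.isImpedanceExp`).

The kernel is `K(x, t) = (f(0) / f(x)) ∫ (a + b)(x, τ) dτ` over `-x < τ < t`
(`goursatKernel`). Integration by parts in `t` gives the representation of `v`; its boundary term is
known because `v = 1` for `ρ = 0`. Continuity of `K` is clear from the formula, and
`∂ₜ K = (f(0) / f) (a + b)`. Each of the two summands of `K` is also absolutely continuous along
its own family of characteristics, since the primitives of `a` and `b` again satisfy the Goursat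
equations. Combining the directional derivatives gives `∂ₓ K = (f(0) / f) (b - a)`
(`IsGoursatPair.hasWeakDeriv_goursatKernel`). Replacing `f` by `1 / f` replaces `(κ, a, b)` by
`(-κ, a, -b)`, which yields the relations between the kernels of `f` and `1 / f`.

For uniqueness (`IsImpedanceKernel.ae_eq`), the solution `v` is determined by Grönwall's inequality,
so the difference of two kernels has, for almost every `x`, vanishing Fourier coefficients with
respect to `e^{iπnt/ℓ}` for all `n ≠ 0`. As a function of `t` on `(-ℓ, ℓ)` it is thus constant, and
it vanishes for `|t| > x`.
-/

noncomputable section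

namespace Impedance

/-! ### Primitives of integrable functions -/

/-- `u` is on `[a, b]` a primitive of the integrable function `g`; equivalently, `u` is absolutely
continuous on `[a, b]` with derivative `g` almost everywhere. -/
structure IsPrimitiveOn (a b : ℝ) (u g : ℝ → ℂ) : Prop where
  integrable : IntervalIntegrable g volume a b
  eq_add : ∀ x ∈ Icc a b, u x = u a + ∫ s in a..x, g s

/-- Absolute continuity is inherited by a function whose increments are dominated by those of an
absolutely continuous function. -/
lemma absolutelyContinuousOnInterval_of_dist_le {X Y : Type*} [PseudoMetricSpace X]
    [PseudoMetricSpace Y] {w : ℝ → X} {u : ℝ → Y} {a b : ℝ}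
    (hw : AbsolutelyContinuousOnInterval w a b) (C : ℝ)
    (h : ∀ x ∈ uIcc a b, ∀ y ∈ uIcc a b, dist (u x) (u y) ≤ C * dist (w x) (w y)) :
    AbsolutelyContinuousOnInterval u a b := by
  unfold AbsolutelyContinuousOnInterval at hw ⊢
  refine squeeze_zero' ?_ ?_ (by simpa using hw.const_mul C)
  · exact Filter.Eventually.of_forall fun _ => Finset.sum_nonneg fun i _ => dist_nonneg
  rw [Filter.eventually_inf_principal]
  filter_upwards with E hE
  rw [Finset.mul_sum]
  refine Finset.sum_le_sum fun i hi => ?_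
  exact h _ (hE.1 i hi).1 _ (hE.1 i hi).2

namespace IsPrimitiveOn

variable {a b : ℝ} {u v g h : ℝ → ℂ}

lemma intervalIntegrable_of_mem (hu : IsPrimitiveOn a b u g) {x y : ℝ} (hx : x ∈ Icc a b)
    (hy : y ∈ Icc a b) : IntervalIntegrable g volume x y := by
  refine hu.integrable.mono_set ?_
  rw [uIcc_of_le (hx.1.trans hx.2)]
  exact uIcc_subset_Icc hx hy

lemma sub_eq (hu : IsPrimitiveOn a b u g) {x y : ℝ} (hx : x ∈ Icc a b) (hy : y ∈ Icc a b) :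
    u y - u x = ∫ s in x..y, g s := by
  have ha : a ∈ Icc a b := ⟨le_rfl, hx.1.trans hx.2⟩
  rw [hu.eq_add x hx, hu.eq_add y hy, add_sub_add_left_eq_sub,
    intervalIntegral.integral_interval_sub_left (hu.intervalIntegrable_of_mem ha hy)
      (hu.intervalIntegrable_of_mem ha hx)]

lemma mono (hu : IsPrimitiveOn a b u g) {c d : ℝ} (hc : c ∈ Icc a b) (hd : d ∈ Icc a b) :
    IsPrimitiveOn c d u g where
  integrable := hu.intervalIntegrable_of_mem hc hd
  eq_add x hx := by
    rw [← hu.sub_eq hc (x := c) (y := x) ⟨hc.1.trans hx.1, hx.2.trans hd.2⟩]; ring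

lemma absolutelyContinuous (hab : a ≤ b) (hu : IsPrimitiveOn a b u g) :
    AbsolutelyContinuousOnInterval u a b := by
  have hw := hu.integrable.norm.absolutelyContinuousOnInterval_intervalIntegral
    (c := a) (by simp)
  refine absolutelyContinuousOnInterval_of_dist_le hw 1 fun x hx y hy => ?_
  rw [uIcc_of_le hab] at hx hy
  have ha : a ∈ Icc a b := ⟨le_rfl, hab⟩
  rw [one_mul, dist_comm, dist_comm (∫ _ in a..x, _), dist_eq_norm, hu.sub_eq hx hy, dist_eq_norm,
    intervalIntegral.integral_interval_sub_left (hu.intervalIntegrable_of_mem ha hy).norm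
      (hu.intervalIntegrable_of_mem ha hx).norm, Real.norm_eq_abs]
  exact intervalIntegral.norm_integral_le_abs_integral_norm

lemma continuousOn (hab : a ≤ b) (hu : IsPrimitiveOn a b u g) : ContinuousOn u (Icc a b) := by
  rw [← uIcc_of_le hab]
  exact (hu.absolutelyContinuous hab).continuousOn

lemma ae_hasDerivAt (hab : a ≤ b) (hu : IsPrimitiveOn a b u g) :
    ∀ᵐ x, x ∈ uIcc a b → HasDerivAt u (g x) x := by
  have h₁ : ∀ᵐ x : ℝ, x ≠ a := by simp [ae_iff, measure_singleton]
  have h₂ : ∀ᵐ x : ℝ, x ≠ b := by simp [ae_iff, measure_singleton]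
  filter_upwards [hu.integrable.ae_hasDerivAt_integral, h₁, h₂] with x hx ha hb hxab
  have hd := (hx hxab a (by simp)).const_add (u a)
  rw [uIcc_of_le hab] at hxab
  refine hd.congr_of_eventuallyEq ?_
  filter_upwards [Icc_mem_nhds (lt_of_le_of_ne hxab.1 ha.symm) (lt_of_le_of_ne hxab.2 hb)]
    with y hy using hu.eq_add y hy

lemma of_absolutelyContinuous (hab : a ≤ b) (hg : IntervalIntegrable g volume a b)
    (hu : AbsolutelyContinuousOnInterval u a b)
    (hd : ∀ᵐ x, x ∈ uIcc a b → HasDerivAt u (g x) x) : IsPrimitiveOn a b u g := by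
  refine ⟨hg, fun x hx => ?_⟩
  have hP : IsPrimitiveOn a b (fun x => ∫ s in a..x, g s) g := ⟨hg, fun x _ => by simp⟩
  obtain ⟨C, hC⟩ := (hu.sub (hP.absolutelyContinuous hab)).const_of_ae_hasDerivAt_zero (by
    filter_upwards [hd, hP.ae_hasDerivAt hab] with x h₁ h₂ hx
    simpa using (h₁ hx).sub (h₂ hx))
  have ha := hC a (by simp)
  have hx' := hC x (by rwa [uIcc_of_le hab])
  simp only [Pi.sub_apply, intervalIntegral.integral_same, sub_zero] at ha hx'
  rw [ha, ← hx']; ring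

lemma congr_deriv (hab : a ≤ b) (hu : IsPrimitiveOn a b u g)
    (hgh : ∀ᵐ x, x ∈ Ioc a b → g x = h x) : IsPrimitiveOn a b u h where
  integrable := by
    refine hu.integrable.congr_ae ?_
    rw [uIoc_of_le hab, Filter.EventuallyEq, ae_restrict_iff' measurableSet_Ioc]
    exact hgh
  eq_add x hx := by
    rw [hu.eq_add x hx]
    congr 1
    refine intervalIntegral.integral_congr_ae ?_
    filter_upwards [hgh] with s hs hsx
    rw [uIoc_of_le hx.1] at hsx
    exact hs ⟨hsx.1, hsx.2.trans hx.2⟩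

lemma congr_fun (hu : IsPrimitiveOn a b u g) (huv : ∀ x ∈ Icc a b, u x = v x) :
    IsPrimitiveOn a b v g where
  integrable := hu.integrable
  eq_add x hx := by
    rw [← huv x hx, ← huv a ⟨le_rfl, hx.1.trans hx.2⟩]; exact hu.eq_add x hx

lemma of_hasDerivAt (hd : ∀ x, HasDerivAt u (g x) x) (hg : Continuous g) :
    IsPrimitiveOn a b u g where
  integrable := hg.intervalIntegrable _ _
  eq_add x _ := by
    rw [intervalIntegral.integral_eq_sub_of_hasDerivAt (fun y _ => hd y)
      (hg.intervalIntegrable _ _)]; ring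

lemma mul (hab : a ≤ b) (hu : IsPrimitiveOn a b u g) (hv : IsPrimitiveOn a b v h) :
    IsPrimitiveOn a b (fun x => u x * v x) (fun x => g x * v x + u x * h x) := by
  have hcu := hu.continuousOn hab
  have hcv := hv.continuousOn hab
  rw [← uIcc_of_le hab] at hcu hcv
  refine of_absolutelyContinuous hab
    ((hu.integrable.mul_continuousOn hcv).add (hv.integrable.continuousOn_mul hcu))
    ((hu.absolutelyContinuous hab).fun_smul (hv.absolutelyContinuous hab)) ?_
  filter_upwards [hu.ae_hasDerivAt hab, hv.ae_hasDerivAt hab] with x h₁ h₂ hx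
  exact (h₁ hx).mul (h₂ hx)

lemma add (hu : IsPrimitiveOn a b u g) (hv : IsPrimitiveOn a b v h) :
    IsPrimitiveOn a b (fun x => u x + v x) (fun x => g x + h x) where
  integrable := hu.integrable.add hv.integrable
  eq_add x hx := by
    have ha : a ∈ Icc a b := ⟨le_rfl, hx.1.trans hx.2⟩
    rw [intervalIntegral.integral_add (hu.intervalIntegrable_of_mem ha hx)
      (hv.intervalIntegrable_of_mem ha hx), hu.eq_add x hx, hv.eq_add x hx]; ring

lemma const_mul (C : ℂ) (hu : IsPrimitiveOn a b u g) :
    IsPrimitiveOn a b (fun x => C * u x) (fun x => C * g x) where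
  integrable := hu.integrable.const_mul C
  eq_add x hx := by
    rw [intervalIntegral.integral_const_mul, hu.eq_add x hx]; ring

lemma sub (hu : IsPrimitiveOn a b u g) (hv : IsPrimitiveOn a b v h) :
    IsPrimitiveOn a b (fun x => u x - v x) (fun x => g x - h x) := by
  simpa [sub_eq_add_neg] using hu.add (hv.const_mul (-1))

lemma inv (hab : a ≤ b) (hu : IsPrimitiveOn a b u g) (h0 : ∀ x ∈ Icc a b, u x ≠ 0) :
    IsPrimitiveOn a b (fun x => (u x)⁻¹) (fun x => -g x / u x ^ 2) := by
  have hcu := hu.continuousOn hab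
  have hci : ContinuousOn (fun x => (u x)⁻¹) (Icc a b) := hcu.inv₀ h0
  obtain ⟨C, hC⟩ := isCompact_Icc.exists_bound_of_continuousOn hci
  have hC0 : 0 ≤ C := (norm_nonneg _).trans (hC a ⟨le_rfl, hab⟩)
  refine of_absolutelyContinuous hab ?_ ?_ ?_
  · have : ContinuousOn (fun x => -((u x)⁻¹ ^ 2)) (uIcc a b) := by
      rw [uIcc_of_le hab]; exact (hci.pow 2).neg
    refine (hu.integrable.mul_continuousOn this).congr_ae (Filter.Eventually.of_forall fun x => ?_)
    simp only [div_eq_mul_inv, inv_pow]; ring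
  · refine absolutelyContinuousOnInterval_of_dist_le (hu.absolutelyContinuous hab) (C * C)
      fun x hx y hy => ?_
    rw [uIcc_of_le hab] at hx hy
    have hx0 := h0 x hx
    have hy0 := h0 y hy
    have : (u x)⁻¹ - (u y)⁻¹ = (u x)⁻¹ * (u y)⁻¹ * (u y - u x) := by field_simp
    rw [dist_eq_norm, this, norm_mul, norm_mul, dist_comm, dist_eq_norm]
    gcongr
    · exact hC x hx
    · exact hC y hy
  · filter_upwards [hu.ae_hasDerivAt hab] with x hx hxab
    exact (hx hxab).inv (h0 x (by rwa [uIcc_of_le hab] at hxab))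

/-- Integration by parts against a function that vanishes at both ends. -/
lemma integral_mul_eq_neg (hab : a ≤ b) (hu : IsPrimitiveOn a b u g) (hv : IsPrimitiveOn a b v h)
    (ha : v a = 0) (hb : v b = 0) : ∫ x in a..b, u x * h x = -∫ x in a..b, g x * v x := by
  have hcu := hu.continuousOn hab
  have hcv := hv.continuousOn hab
  rw [← uIcc_of_le hab] at hcu hcv
  have := (hu.mul hab hv).sub_eq (x := a) (y := b) ⟨le_rfl, hab⟩ ⟨hab, le_rfl⟩
  rw [ha, hb, intervalIntegral.integral_add (hu.integrable.mul_continuousOn hcv)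
    (hv.integrable.continuousOn_mul hcu)] at this
  linear_combination -this

end IsPrimitiveOn

/-! ### The Goursat problem in characteristic coordinates -/

/-- A Volterra integral with integrable weight and continuous kernel depends continuously on both
limits of integration and on the parameter. -/
lemma continuous_integral_Ioc_mul {k : ℝ → ℂ} (hk : Integrable k) {H : ℝ × ℝ → ℝ → ℂ}
    (hH : Continuous (Function.uncurry H)) :
    Continuous fun p : ℝ × ℝ => ∫ s in Ioc p.2 p.1, k s * H p s := by
  rw [continuous_iff_continuousAt]
  intro p₀
  simp_rw [← integral_indicator measurableSet_Ioc]
  obtain ⟨C, hC⟩ := ((isCompact_closedBall p₀ 1).prod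
    (isCompact_Icc (a := p₀.2 - 1) (b := p₀.1 + 1))).exists_bound_of_continuousOn hH.continuousOn
  have hs (p : ℝ × ℝ) : Continuous (H p) := hH.comp (by fun_prop : Continuous fun s => (p, s))
  refine continuousAt_of_dominated (bound := fun s => |C| * ‖k s‖) ?_ ?_
    (hk.norm.const_mul |C|) ?_
  · exact Filter.Eventually.of_forall fun p =>
      (hk.aestronglyMeasurable.mul (hs p).aestronglyMeasurable).indicator measurableSet_Ioc
  · filter_upwards [Metric.closedBall_mem_nhds p₀ one_pos] with p hp
    refine Filter.Eventually.of_forall fun s => ?_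
    by_cases hsp : s ∈ Ioc p.2 p.1
    · rw [indicator_of_mem hsp, norm_mul, mul_comm]
      gcongr
      refine (hC (p, s) (mk_mem_prod hp ?_)).trans (le_abs_self C)
      have hp' := hp
      rw [Metric.mem_closedBall, Prod.dist_eq, max_le_iff, Real.dist_eq, Real.dist_eq, abs_le,
        abs_le] at hp'
      exact ⟨by linarith [hsp.1, hp'.2.1], by linarith [hsp.2, hp'.1.2]⟩
    · rw [indicator_of_notMem hsp, norm_zero]
      positivity
  · have h₁ : ∀ᵐ s : ℝ, s ≠ p₀.1 := by simp [ae_iff, measure_singleton]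
    have h₂ : ∀ᵐ s : ℝ, s ≠ p₀.2 := by simp [ae_iff, measure_singleton]
    filter_upwards [h₁, h₂] with s h₁ h₂
    have hcont : ContinuousAt (fun p : ℝ × ℝ => k s * H p s) p₀ :=
      (continuous_const.mul (hH.comp (by fun_prop : Continuous fun p : ℝ × ℝ => (p, s)))).continuousAt
    by_cases hsp : s ∈ Ioo p₀.2 p₀.1
    · refine hcont.congr ?_
      filter_upwards [continuous_snd.continuousAt.eventually_lt_const hsp.1,
        continuous_fst.continuousAt.eventually_const_lt hsp.2] with p hp1 hp2
      rw [indicator_of_mem (show s ∈ Ioc p.2 p.1 from ⟨hp1, hp2.le⟩)]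
    · refine (continuousAt_const (y := (0 : ℂ))).congr ?_
      have : s < p₀.2 ∨ p₀.1 < s := by
        by_contra! hcon
        exact hsp ⟨lt_of_le_of_ne hcon.1 h₂.symm, lt_of_le_of_ne hcon.2 h₁⟩
      rcases this with h | h
      · filter_upwards [continuous_snd.continuousAt.eventually_const_lt h] with p hp
        rw [indicator_of_notMem fun hm => absurd hm.1 (not_lt.2 hp.le)]
      · filter_upwards [continuous_fst.continuousAt.eventually_lt_const h] with p hp
        rw [indicator_of_notMem fun hm => absurd hm.2 (not_le.2 hp)]

/-- The Goursat problem `∂ₓ a(x, η) = κ(x) b(x, x - η)`, `∂ₓ b(x, ξ) = κ(x) a(x, x - ξ)` with data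
`a(η, η) = 0` and `b(ξ, ξ) = κ(ξ) / 2`, in integrated form. The unknown `b` is recorded through
its continuous part `c(x, ξ) = b(x, ξ) - κ(ξ) / 2`. -/
structure IsGoursatPair (κ : ℝ → ℂ) (a c : ℝ → ℝ → ℂ) : Prop where
  continuous_left : Continuous (Function.uncurry a)
  continuous_right : Continuous (Function.uncurry c)
  left_eq : ∀ x η, a x η = ∫ s in Ioc η x, κ s * (κ (s - η) / 2 + c s (s - η))
  right_eq : ∀ x ξ, c x ξ = ∫ s in Ioc ξ x, κ s * a s (s - ξ)

lemma IsGoursatPair.neg {κ : ℝ → ℂ} {a c : ℝ → ℝ → ℂ} (h : IsGoursatPair κ a c) :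
    IsGoursatPair (fun s => -κ s) a (fun x ξ => -c x ξ) where
  continuous_left := h.continuous_left
  continuous_right := h.continuous_right.neg
  left_eq x η := by
    rw [h.left_eq]
    congr 1; ext s; ring
  right_eq x ξ := by
    simp only [h.right_eq x ξ, neg_mul, integral_neg]

/-- Young's inequality, integrated. -/
lemma setIntegral_norm_mul_le {u v : ℝ → ℂ} (hu : MemLp u 2) (hv : MemLp v 2) (S : Set ℝ)
    {ε : ℝ} (hε : 0 < ε) :
    ∫ s in S, ‖u s * v s‖ ≤ (ε * ∫ s, ‖u s‖ ^ 2) / 2 + (∫ s, ‖v s‖ ^ 2) / (2 * ε) := by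
  have hu2 : Integrable fun s => ‖u s‖ ^ 2 := by
    exact_mod_cast hu.integrable_norm_pow (p := 2) (by norm_num)
  have hv2 : Integrable fun s => ‖v s‖ ^ 2 := by
    exact_mod_cast hv.integrable_norm_pow (p := 2) (by norm_num)
  calc ∫ s in S, ‖u s * v s‖ ≤ ∫ s, ‖u s * v s‖ := by
        refine setIntegral_le_integral (hu.integrable_mul hv).norm ?_
        exact Filter.Eventually.of_forall fun s => norm_nonneg _
    _ ≤ ∫ s, (ε / 2 * ‖u s‖ ^ 2 + 1 / (2 * ε) * ‖v s‖ ^ 2) := by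
        refine integral_mono (hu.integrable_mul hv).norm
          ((hu2.const_mul _).add (hv2.const_mul _)) fun s => ?_
        simp only [norm_mul]
        rw [← sub_nonneg]
        have : ε / 2 * ‖u s‖ ^ 2 + 1 / (2 * ε) * ‖v s‖ ^ 2 - ‖u s‖ * ‖v s‖ =
          (ε * ‖u s‖ - ‖v s‖) ^ 2 / (2 * ε) := by field_simp; ring
        rw [this]; positivity
    _ = _ := by
        rw [integral_add (hu2.const_mul _) (hv2.const_mul _), integral_const_mul,
          integral_const_mul]; ring

lemma memLp_comp_sub {u : ℝ → ℂ} {p : ENNReal} (hu : MemLp u p) (η : ℝ) :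
    MemLp (fun s => u (s - η)) p :=
  hu.comp_measurePreserving (measurePreserving_sub_right volume η)

/-- The correlation integral of a square integrable function is continuous in the limits of
integration and the shift: it is a uniform limit of integrals with continuous kernel. -/
lemma continuous_integral_Ioc_mul_comp_sub {κ : ℝ → ℂ} (hκ : MemLp κ 2) (hκ1 : Integrable κ) :
    Continuous fun p : ℝ × ℝ => ∫ s in Ioc p.2 p.1, κ s * κ (s - p.2) := by
  refine continuous_of_uniform_approx_of_continuous fun w hw => ?_
  obtain ⟨r, hr, hrw⟩ := Metric.mem_uniformity_dist.1 hw
  set N := ∫ s, ‖κ s‖ ^ 2 with hN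
  have hN0 : 0 ≤ N := integral_nonneg fun s => by positivity
  -- With this `ε`, both terms of Young's inequality are smaller than `r / 2`.
  set ε := r / (N + 1) with hε
  have hε0 : 0 < ε := by positivity
  obtain ⟨κ', -, hdist, hcont, hmem⟩ := MemLp.exists_hasCompactSupport_integral_rpow_sub_le
    (p := 2) (by norm_num) (f := κ) (by simpa using hκ) (ε := r * ε / 2) (by positivity)
  replace hmem : MemLp κ' 2 := by simpa using hmem
  replace hdist : ∫ s, ‖κ s - κ' s‖ ^ 2 ≤ r * ε / 2 := by exact_mod_cast hdist
  refine ⟨fun p => ∫ s in Ioc p.2 p.1, κ s * κ' (s - p.2),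
    continuous_integral_Ioc_mul hκ1 (H := fun p s => κ' (s - p.2)) (by
      unfold Function.uncurry; fun_prop), fun p => hrw ?_⟩
  have h1 : Integrable fun s => κ s * κ (s - p.2) := hκ.integrable_mul (memLp_comp_sub hκ _)
  have h2 : Integrable fun s => κ s * κ' (s - p.2) := hκ.integrable_mul (memLp_comp_sub hmem _)
  have hd : MemLp (fun s => κ s - κ' s) 2 := hκ.sub hmem
  rw [dist_eq_norm, ← integral_sub h1.integrableOn h2.integrableOn]
  simp_rw [← mul_sub]
  refine (norm_integral_le_integral_norm _).trans_lt ?_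
  refine (setIntegral_norm_mul_le hκ (memLp_comp_sub hd p.2) _ hε0).trans_lt ?_
  rw [integral_sub_right_eq_self (fun s => ‖κ s - κ' s‖ ^ 2) p.2, ← hN]
  have e1 : ε * N < r := by
    rw [hε, div_mul_eq_mul_div, div_lt_iff₀ (by positivity)]; nlinarith
  have e2 : (∫ s, ‖κ s - κ' s‖ ^ 2) / (2 * ε) ≤ r / 4 := by
    rw [div_le_iff₀ (by positivity)]; nlinarith
  linarith

lemma integral_exp_sq_le {lam : ℝ} (hlam : 0 < lam) (η x : ℝ) :
    ∫ s in Ioc η x, Real.exp (-lam * (x - s)) ^ 2 ≤ 1 / (2 * lam) := by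
  rcases le_total x η with h | h
  · rw [Ioc_eq_empty (not_lt.2 h)]; simp; positivity
  rw [← intervalIntegral.integral_of_le h]
  have hd (s : ℝ) : HasDerivAt (fun s => Real.exp (-(2 * lam) * (x - s)) / (2 * lam))
      (Real.exp (-lam * (x - s)) ^ 2) s := by
    have := ((((hasDerivAt_id s).const_sub x).const_mul (-(2 * lam))).exp).div_const (2 * lam)
    refine this.congr_deriv ?_
    rw [← Real.exp_nat_mul]
    simp only [id]
    field_simp
    push_cast
    ring_nf
  rw [intervalIntegral.integral_eq_sub_of_hasDerivAt (fun s _ => hd s)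
    ((by fun_prop : Continuous _).intervalIntegrable _ _)]
  simp only [sub_self, mul_zero, Real.exp_zero]
  have : 0 ≤ Real.exp (-(2 * lam) * (x - η)) / (2 * lam) := by positivity
  linarith

open scoped BoundedContinuousFunction

/-- The Volterra operator of the Goursat problem, conjugated with an exponential weight
`exp (lam * x)`, is a contraction of the bounded continuous functions once `lam` is large. -/
lemma exists_contracting_volterra {κ : ℝ → ℂ} (hκ : MemLp κ 2) (hκ1 : Integrable κ) :
    ∃ lam : ℝ, 0 < lam ∧ ∃ V : (ℝ × ℝ →ᵇ ℂ) → (ℝ × ℝ →ᵇ ℂ),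
      (∀ g p, V g p = ∫ s in Ioc p.2 p.1,
        κ s * (Real.exp (-lam * (p.1 - s)) * g (s, s - p.2))) ∧
      ∀ g h, dist (V g) (V h) ≤ 3 / 4 * dist g h := by
  set N := ∫ s, ‖κ s‖ ^ 2 with hN
  have hN0 : 0 ≤ N := integral_nonneg fun s => by positivity
  set lam := N + 1 with hlam
  have hlam0 : 0 < lam := by positivity
  have key (x η B : ℝ) (hB : 0 ≤ B) (G : ℝ → ℂ) (hG : ∀ s, ‖G s‖ ≤ B) :
      ‖∫ s in Ioc η x, κ s * (Real.exp (-lam * (x - s)) * G s)‖ ≤ 3 / 4 * B := by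
    set v : ℝ → ℂ := (Ioc η x).indicator fun s => (Real.exp (-lam * (x - s)) : ℂ) with hv
    have hvm : MemLp v 2 := by
      rw [hv, memLp_indicator_iff_restrict measurableSet_Ioc]
      have hc : Continuous fun s => (Real.exp (-lam * (x - s)) : ℂ) := by fun_prop
      refine MemLp.of_bound hc.aestronglyMeasurable 1 ?_
      refine (ae_restrict_iff' measurableSet_Ioc).2 (Filter.Eventually.of_forall fun s hs => ?_)
      rw [Complex.norm_real, Real.norm_eq_abs, Real.abs_exp, Real.exp_le_one_iff]
      nlinarith [hs.2]
    have hv2 : ∫ s, ‖v s‖ ^ 2 ≤ 1 / (2 * lam) := by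
      refine le_trans (le_of_eq ?_) (integral_exp_sq_le hlam0 η x)
      rw [← integral_indicator measurableSet_Ioc]
      congr 1; ext s
      by_cases hs : s ∈ Ioc η x
      · simp only [hv, indicator_of_mem hs, Complex.norm_real, Real.norm_eq_abs, Real.abs_exp]
      · simp [hv, indicator_of_notMem hs]
    have hint : Integrable fun s => ‖κ s * v s‖ := (hκ.integrable_mul hvm).norm
    calc ‖∫ s in Ioc η x, κ s * (Real.exp (-lam * (x - s)) * G s)‖
        ≤ ∫ s in Ioc η x, ‖κ s * v s‖ * B := by
          refine norm_integral_le_of_norm_le (hint.integrableOn.mul_const B) ?_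
          refine (ae_restrict_iff' measurableSet_Ioc).2 (Filter.Eventually.of_forall fun s hs => ?_)
          rw [hv, indicator_of_mem hs, ← mul_assoc, norm_mul]
          gcongr
          exact hG s
      _ = (∫ s in Ioc η x, ‖κ s * v s‖) * B := integral_mul_const _ _
      _ ≤ 3 / 4 * B := by
          refine mul_le_mul_of_nonneg_right ?_ hB
          refine (setIntegral_norm_mul_le hκ hvm _ (ε := 1 / (N + 1)) (by positivity)).trans ?_
          rw [← hN]
          have e1 : 1 / (N + 1) * N ≤ 1 := by
            rw [one_div_mul_eq_div, div_le_one (by positivity)]; linarith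
          have e2 : (∫ s, ‖v s‖ ^ 2) / (2 * (1 / (N + 1))) ≤ 1 / 4 := by
            rw [div_le_iff₀ (by positivity)]
            refine hv2.trans (le_of_eq ?_)
            rw [hlam]; field_simp; norm_num
          linarith
  have hcont (g : ℝ × ℝ →ᵇ ℂ) : Continuous fun p : ℝ × ℝ => ∫ s in Ioc p.2 p.1,
      κ s * (Real.exp (-lam * (p.1 - s)) * g (s, s - p.2)) :=
    continuous_integral_Ioc_mul hκ1
      (H := fun p s => Real.exp (-lam * (p.1 - s)) * g (s, s - p.2)) (by
        unfold Function.uncurry; fun_prop)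
  refine ⟨lam, hlam0, fun g => BoundedContinuousFunction.ofNormedAddCommGroup _ (hcont g)
    (3 / 4 * ‖g‖) fun p => key _ _ _ (norm_nonneg _) _ fun s => g.norm_coe_le_norm _,
    fun g p => rfl, fun g h => ?_⟩
  refine (BoundedContinuousFunction.dist_le (by positivity)).2 fun p => ?_
  have hi (g : ℝ × ℝ →ᵇ ℂ) : IntegrableOn
      (fun s => κ s * (Real.exp (-lam * (p.1 - s)) * g (s, s - p.2))) (Ioc p.2 p.1) := by
    have hc : Continuous fun s => Real.exp (-lam * (p.1 - s)) * g (s, s - p.2) := by fun_prop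
    exact (hκ1.integrableOn.mul_continuousOn hc.continuousOn isCompact_Icc).mono_set
      Ioc_subset_Icc_self
  rw [dist_eq_norm]
  simp only [BoundedContinuousFunction.coe_ofNormedAddCommGroup]
  rw [← integral_sub (hi g) (hi h)]
  simp_rw [← mul_sub]
  refine key p.1 p.2 _ dist_nonneg _ fun s => ?_
  rw [← dist_eq_norm]
  exact BoundedContinuousFunction.dist_coe_le_dist _

/-- The Goursat problem is solvable for square integrable `κ` supported in a bounded interval to
the right of the origin. -/
theorem exists_isGoursatPair {κ : ℝ → ℂ} (hκ : MemLp κ 2) (hκ1 : Integrable κ)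
    (hκ0 : ∀ s ≤ 0, κ s = 0) : ∃ a c, IsGoursatPair κ a c := by
  obtain ⟨lam, hlam, V, hV, hVd⟩ := exists_contracting_volterra hκ hκ1
  set N := ∫ s, ‖κ s‖ ^ 2 with hN
  have hN0 : 0 ≤ N := integral_nonneg fun s => by positivity
  set F : ℝ × ℝ → ℂ := fun p => ∫ s in Ioc p.2 p.1, κ s * κ (s - p.2) with hF
  have hFc : Continuous F := continuous_integral_Ioc_mul_comp_sub hκ hκ1
  have hFN (p : ℝ × ℝ) : ‖F p‖ ≤ N := by
    refine (norm_integral_le_integral_norm _).trans ?_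
    refine (setIntegral_norm_mul_le hκ (memLp_comp_sub hκ p.2) _ one_pos).trans (le_of_eq ?_)
    rw [integral_sub_right_eq_self (fun s => ‖κ s‖ ^ 2) p.2, ← hN]; ring
  have hF0 (p : ℝ × ℝ) (hp : p.1 ≤ 0) : F p = 0 := by
    refine setIntegral_eq_zero_of_forall_eq_zero fun s hs => ?_
    rw [hκ0 s (hs.2.trans hp), zero_mul]
  -- The inhomogeneity `F / 2`, multiplied with the weight.
  let g₀ : ℝ × ℝ →ᵇ ℂ := BoundedContinuousFunction.ofNormedAddCommGroup
    (fun p => Real.exp (-lam * p.1) * (F p / 2)) (by fun_prop) N fun p => by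
      rcases le_total p.1 0 with h | h
      · rw [hF0 p h]; simpa using hN0
      · have h1 : Real.exp (-lam * p.1) ≤ 1 := Real.exp_le_one_iff.2 (by nlinarith)
        rw [norm_mul, Complex.norm_real, Real.norm_eq_abs, Real.abs_exp, norm_div]
        have h2 := hFN p
        have h3 := norm_nonneg (F p)
        have h4 : ‖(2 : ℂ)‖ = 2 := by simp
        rw [h4]
        nlinarith [Real.exp_pos (-lam * p.1)]
  have hT : ContractingWith (3 / 4) fun g => g₀ + V (V g) := by
    refine ⟨by rw [← NNReal.coe_lt_coe]; norm_num, LipschitzWith.of_dist_le_mul fun g h => ?_⟩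
    rw [dist_add_left]
    push_cast
    have h1 := hVd (V g) (V h)
    have h2 := hVd g h
    have h3 : 0 ≤ dist g h := dist_nonneg
    linarith
  obtain ⟨g, hg⟩ : ∃ g : ℝ × ℝ →ᵇ ℂ, g₀ + V (V g) = g := ⟨_, hT.fixedPoint_isFixedPt⟩
  -- Undo the exponential weight.
  have hE (h : ℝ × ℝ →ᵇ ℂ) (x η : ℝ) : Real.exp (lam * x) * V h (x, η) =
      ∫ s in Ioc η x, κ s * (Real.exp (lam * s) * h (s, s - η)) := by
    rw [hV, ← integral_const_mul]
    congr 1; ext s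
    have : (Real.exp (lam * s) : ℂ) = Real.exp (lam * x) * Real.exp (-lam * (x - s)) := by
      rw [← Complex.ofReal_mul, ← Real.exp_add]; ring_nf
    simp only
    rw [this]; ring
  refine ⟨fun x η => Real.exp (lam * x) * g (x, η), fun x ξ => Real.exp (lam * x) * V g (x, ξ),
    by unfold Function.uncurry; fun_prop, by unfold Function.uncurry; fun_prop, fun x η => ?_,
    fun x ξ => hE g x ξ⟩
  have hi1 : IntegrableOn (fun s => κ s * (κ (s - η) / 2)) (Ioc η x) := by
    have : Integrable fun s => κ s * κ (s - η) := hκ.integrable_mul (memLp_comp_sub hκ _)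
    simpa only [mul_div_assoc] using (this.div_const 2).integrableOn
  have hi2 : IntegrableOn (fun s => κ s * (Real.exp (lam * s) * V g (s, s - η))) (Ioc η x) := by
    have hc : Continuous fun s => Real.exp (lam * s) * V g (s, s - η) := by fun_prop
    exact (hκ1.integrableOn.mul_continuousOn hc.continuousOn isCompact_Icc).mono_set
      Ioc_subset_Icc_self
  simp_rw [mul_add]
  rw [integral_add hi1 hi2, ← hE, ← hg]
  conv_rhs => rw [hg]
  simp only [BoundedContinuousFunction.coe_add, Pi.add_apply, mul_add]
  congr 1
  change (Real.exp (lam * x) : ℂ) * (Real.exp (-lam * x) * (F (x, η) / 2)) = _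
  rw [← mul_assoc, ← Complex.ofReal_mul, ← Real.exp_add]
  simp only [neg_mul, add_neg_cancel, Real.exp_zero, Complex.ofReal_one, one_mul, hF]
  rw [← integral_div]
  congr 1; ext s; ring

/-! ### Fubini identities for a Goursat pair -/

/-- Fubini's theorem on the triangle `η < y < s ≤ x`. -/
lemma integral_integral_triangle_swap {F : ℝ → ℝ → ℂ} {η x : ℝ} (hηx : η ≤ x)
    (hF : IntegrableOn (Function.uncurry F) (Ioc η x ×ˢ Ioc η x)) :
    ∫ y in η..x, ∫ s in Ioc y x, F s y = ∫ s in η..x, ∫ y in η..s, F s y := by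
  have hT : MeasurableSet {p : ℝ × ℝ | p.2 < p.1} :=
    measurableSet_lt measurable_snd measurable_fst
  have hG : Integrable (Function.uncurry fun s y => (Iio s).indicator (F s) y)
      ((volume.restrict (Ioc η x)).prod (volume.restrict (Ioc η x))) := by
    rw [Measure.prod_restrict, ← Measure.volume_eq_prod]
    refine (hF.indicator hT).congr (Filter.Eventually.of_forall fun p => ?_)
    by_cases hp : p.2 < p.1
    · rw [indicator_of_mem (show p ∈ {p : ℝ × ℝ | p.2 < p.1} from hp)]
      simp [Function.uncurry, hp]
    · rw [indicator_of_notMem (show p ∉ {p : ℝ × ℝ | p.2 < p.1} from hp)]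
      simp [Function.uncurry, hp]
  rw [intervalIntegral.integral_of_le hηx, intervalIntegral.integral_of_le hηx]
  calc ∫ y in Ioc η x, ∫ s in Ioc y x, F s y
      = ∫ y in Ioc η x, ∫ s in Ioc η x, (Iio s).indicator (F s) y := by
        refine setIntegral_congr_fun measurableSet_Ioc fun y hy => ?_
        have : (fun s => (Iio s).indicator (F s) y) = (Ioi y).indicator fun s => F s y := by
          ext s
          by_cases h : y < s <;> simp [h]
        rw [this, setIntegral_indicator measurableSet_Ioi]
        congr 2
        ext s
        simp only [mem_Ioc, mem_inter_iff, mem_Ioi]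
        exact ⟨fun h => ⟨⟨hy.1.trans h.1, h.2⟩, h.1⟩, fun h => ⟨h.2, h.1.2⟩⟩
    _ = ∫ s in Ioc η x, ∫ y in Ioc η x, (Iio s).indicator (F s) y :=
        (integral_integral_swap hG).symm
    _ = ∫ s in Ioc η x, ∫ y in η..s, F s y := by
        refine setIntegral_congr_fun measurableSet_Ioc fun s hs => ?_
        rw [setIntegral_indicator measurableSet_Iio, intervalIntegral.integral_of_le hs.1.le,
          integral_Ioc_eq_integral_Ioo]
        congr 2
        ext y
        simp only [mem_Ioc, mem_inter_iff, mem_Iio, mem_Ioo]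
        exact ⟨fun h => ⟨h.1.1, h.2⟩, fun h => ⟨⟨h.1, h.2.le.trans hs.2⟩, h.2⟩⟩

lemma integrableOn_mul_of_continuous {κ : ℝ → ℂ} (hκ1 : Integrable κ) {H : ℝ → ℝ → ℂ}
    (hH : Continuous (Function.uncurry H)) (x y x' y' : ℝ) :
    IntegrableOn (Function.uncurry fun s z => κ s * H s z) (Ioc x y ×ˢ Ioc x' y') := by
  have h1 : IntegrableOn (fun p : ℝ × ℝ => κ p.1) (Icc x y ×ˢ Icc x' y') := by
    rw [IntegrableOn, Measure.volume_eq_prod, ← Measure.prod_restrict]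
    exact hκ1.integrableOn.comp_fst _
  exact (h1.mul_continuousOn hH.continuousOn (isCompact_Icc.prod isCompact_Icc)).mono_set
    (prod_mono Ioc_subset_Icc_self Ioc_subset_Icc_self)

lemma measurePreserving_prod_sub_left :
    MeasurePreserving fun p : ℝ × ℝ => (p.1, p.1 - p.2) :=
  (MeasurePreserving.id _).skew_product (g := fun s z => s - z)
    (by unfold Function.uncurry; fun_prop) (Filter.Eventually.of_forall fun s =>
      (Measure.measurePreserving_sub_left volume s).map_eq)

lemma integrableOn_mul_comp_sub_mul {κ : ℝ → ℂ} (hκ1 : Integrable κ) {w : ℝ → ℂ}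
    (hw : Continuous w) (x y x' y' : ℝ) :
    IntegrableOn (Function.uncurry fun s z => κ s * (w z * (κ (s - z) / 2)))
      (Ioc x y ×ˢ Ioc x' y') := by
  have h1 : Integrable fun p : ℝ × ℝ => κ p.1 * κ (p.1 - p.2) :=
    measurePreserving_prod_sub_left.integrable_comp_of_integrable (hκ1.mul_prod hκ1)
  have h2 : IntegrableOn (fun p : ℝ × ℝ => κ p.1 * κ (p.1 - p.2) * (w p.2 / 2))
      (Icc x y ×ˢ Icc x' y') :=
    h1.integrableOn.mul_continuousOn (by fun_prop) (isCompact_Icc.prod isCompact_Icc)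
  refine (h2.mono_set (prod_mono Ioc_subset_Icc_self Ioc_subset_Icc_self)).congr_fun
    (fun p _ => ?_) (measurableSet_Ioc.prod measurableSet_Ioc)
  simp only [Function.uncurry]; ring

/-- The second unknown `b(x, ξ) = κ(ξ) / 2 + c(x, ξ)` of the Goursat problem. -/
def goursatRight (κ : ℝ → ℂ) (c : ℝ → ℝ → ℂ) (x ξ : ℝ) : ℂ := κ ξ / 2 + c x ξ

/-- The primitive of `a` along the slice `{x}`, in the characteristic coordinate `η`, vanishing
at `η = x`. -/
def leftPrimitive (a : ℝ → ℝ → ℂ) (x η : ℝ) : ℂ := 2 * ∫ y in η..x, a x y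

/-- The primitive of `b` along the slice `{x}`, in the characteristic coordinate `ξ`, vanishing
at `ξ = 0`. -/
def rightPrimitive (κ : ℝ → ℂ) (c : ℝ → ℝ → ℂ) (x ξ : ℝ) : ℂ :=
  2 * ∫ y in (0 : ℝ)..ξ, goursatRight κ c x y

lemma intervalIntegrable_goursatRight {κ : ℝ → ℂ} {c : ℝ → ℝ → ℂ} (hκ1 : Integrable κ)
    (hc : Continuous (Function.uncurry c)) (x y z : ℝ) :
    IntervalIntegrable (goursatRight κ c x) volume y z := by
  have : Continuous (c x) := hc.comp (by fun_prop : Continuous fun ξ => (x, ξ))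
  exact (hκ1.div_const 2).intervalIntegrable.add (this.intervalIntegrable _ _)

/-- Weighted primitives of `b` are continuous, although `b` is not. -/
lemma continuous_integral_mul_goursatRight {κ : ℝ → ℂ} {c : ℝ → ℝ → ℂ} (hκ1 : Integrable κ)
    (hc : Continuous (Function.uncurry c)) {w : ℝ → ℂ} (hw : Continuous w) :
    Continuous fun p : ℝ × ℝ => ∫ y in (0 : ℝ)..p.2, w y * goursatRight κ c p.1 y := by
  have hcx (x : ℝ) : Continuous (c x) := hc.comp (by fun_prop : Continuous fun ξ => (x, ξ))
  have hi (y z : ℝ) : IntervalIntegrable (fun y => w y * (κ y / 2)) volume y z :=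
    (hκ1.div_const 2).intervalIntegrable.continuousOn_mul hw.continuousOn
  have : (fun p : ℝ × ℝ => ∫ y in (0 : ℝ)..p.2, w y * goursatRight κ c p.1 y) =
      fun p => (∫ y in (0 : ℝ)..p.2, w y * (κ y / 2)) + ∫ y in (0 : ℝ)..p.2, w y * c p.1 y := by
    ext p
    have := hcx p.1
    rw [← intervalIntegral.integral_add (hi _ _)
      ((by fun_prop : Continuous fun y => w y * c p.1 y).intervalIntegrable _ _)]
    simp only [goursatRight, mul_add]
  rw [this]
  refine ((intervalIntegral.continuous_primitive hi 0).comp continuous_snd).add ?_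
  refine intervalIntegral.continuous_parametric_intervalIntegral_of_continuous
    (f := fun (p : ℝ × ℝ) y => w y * c p.1 y) ?_ continuous_snd
  have : Continuous fun q : (ℝ × ℝ) × ℝ => c q.1.1 q.2 :=
    hc.comp (by fun_prop : Continuous fun q : (ℝ × ℝ) × ℝ => (q.1.1, q.2))
  unfold Function.uncurry
  fun_prop

lemma continuous_rightPrimitive {κ : ℝ → ℂ} {c : ℝ → ℝ → ℂ} (hκ1 : Integrable κ)
    (hc : Continuous (Function.uncurry c)) :
    Continuous fun p : ℝ × ℝ => rightPrimitive κ c p.1 p.2 := by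
  have := continuous_integral_mul_goursatRight hκ1 hc (w := fun _ => 1) continuous_const
  simp only [one_mul] at this
  exact continuous_const.mul this

lemma continuous_integral_mul_left {a : ℝ → ℝ → ℂ} (ha : Continuous (Function.uncurry a))
    {w : ℝ → ℂ} (hw : Continuous w) :
    Continuous fun p : ℝ × ℝ => ∫ y in p.2..p.1, w y * a p.1 y := by
  have hax (x : ℝ) : Continuous (a x) := ha.comp (by fun_prop : Continuous fun ξ => (x, ξ))
  have h (g : ℝ × ℝ → ℝ) (hg : Continuous g) :
      Continuous fun p : ℝ × ℝ => ∫ y in (0 : ℝ)..g p, w y * a p.1 y := by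
    refine intervalIntegral.continuous_parametric_intervalIntegral_of_continuous
      (f := fun (p : ℝ × ℝ) y => w y * a p.1 y) ?_ hg
    have : Continuous fun q : (ℝ × ℝ) × ℝ => a q.1.1 q.2 :=
      ha.comp (by fun_prop : Continuous fun q : (ℝ × ℝ) × ℝ => (q.1.1, q.2))
    unfold Function.uncurry
    fun_prop
  refine ((h _ continuous_fst).sub (h _ continuous_snd)).congr fun p => ?_
  have := hax p.1
  have hi (y z : ℝ) : IntervalIntegrable (fun y => w y * a p.1 y) volume y z :=
    (by fun_prop : Continuous fun y => w y * a p.1 y).intervalIntegrable _ _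
  exact intervalIntegral.integral_interval_sub_left (hi _ _) (hi _ _)

lemma continuous_leftPrimitive {a : ℝ → ℝ → ℂ} (ha : Continuous (Function.uncurry a)) :
    Continuous fun p : ℝ × ℝ => leftPrimitive a p.1 p.2 := by
  have := continuous_integral_mul_left ha (w := fun _ => 1) continuous_const
  simp only [one_mul] at this
  exact continuous_const.mul this

namespace IsGoursatPair

variable {κ : ℝ → ℂ} {a c : ℝ → ℝ → ℂ}

lemma continuous_right_apply (h : IsGoursatPair κ a c) (x : ℝ) : Continuous (c x) :=
  h.continuous_right.comp (by fun_prop : Continuous fun ξ => (x, ξ))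

lemma continuous_left_apply (h : IsGoursatPair κ a c) (x : ℝ) : Continuous (a x) :=
  h.continuous_left.comp (by fun_prop : Continuous fun ξ => (x, ξ))

/-- The first Goursat equation, integrated over a slice. -/
lemma integral_mul_left (h : IsGoursatPair κ a c) (hκ1 : Integrable κ) {w : ℝ → ℂ}
    (hw : Continuous w) {η x : ℝ} (hηx : η ≤ x) :
    ∫ y in η..x, w y * a x y =
      ∫ s in η..x, κ s * ∫ y in η..s, w y * goursatRight κ c s (s - y) := by
  have hcc : Continuous fun p : ℝ × ℝ => c p.1 (p.1 - p.2) :=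
    h.continuous_right.comp (by fun_prop : Continuous fun p : ℝ × ℝ => (p.1, p.1 - p.2))
  have hF : IntegrableOn (Function.uncurry fun s y => κ s * (w y * goursatRight κ c s (s - y)))
      (Ioc η x ×ˢ Ioc η x) := by
    refine ((integrableOn_mul_comp_sub_mul hκ1 hw η x η x).add
      (integrableOn_mul_of_continuous hκ1 (H := fun s z => w z * c s (s - z))
        ((hw.comp continuous_snd).mul hcc) η x η x)).congr_fun (fun p _ => ?_)
      (measurableSet_Ioc.prod measurableSet_Ioc)
    simp only [Function.uncurry, goursatRight, Pi.add_apply]; ring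
  have := integral_integral_triangle_swap hηx hF
  simp only [intervalIntegral.integral_const_mul] at this
  rw [← this]
  congr 1; ext y
  rw [h.left_eq, ← integral_const_mul]
  congr 1; ext s
  simp only [goursatRight]; ring

/-- The second Goursat equation, integrated over a slice. -/
lemma integral_mul_right (h : IsGoursatPair κ a c) (hκ1 : Integrable κ) {w : ℝ → ℂ}
    (hw : Continuous w) {ξ x : ℝ} (hξx : ξ ≤ x) :
    ∫ y in ξ..x, w y * c x y = ∫ s in ξ..x, κ s * ∫ y in ξ..s, w y * a s (s - y) := by
  have hac : Continuous fun p : ℝ × ℝ => a p.1 (p.1 - p.2) :=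
    h.continuous_left.comp (by fun_prop : Continuous fun p : ℝ × ℝ => (p.1, p.1 - p.2))
  have := integral_integral_triangle_swap hξx
    (integrableOn_mul_of_continuous hκ1 (H := fun s z => w z * a s (s - z))
      ((hw.comp continuous_snd).mul hac) ξ x ξ x)
  simp only [intervalIntegral.integral_const_mul] at this
  rw [← this]
  congr 1; ext y
  rw [h.right_eq, ← integral_const_mul]
  congr 1; ext s; ring

/-- Along the characteristic `η = const`, the primitive of `a` solves the same equation as `a`. -/
lemma isPrimitiveOn_leftPrimitive (h : IsGoursatPair κ a c) (hκ1 : Integrable κ) (η X : ℝ) :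
    IsPrimitiveOn η X (fun x => leftPrimitive a x η)
      (fun s => κ s * rightPrimitive κ c s (s - η)) where
  integrable := by
    have : Continuous fun s => rightPrimitive κ c s (s - η) :=
      (continuous_rightPrimitive hκ1 h.continuous_right).comp
        (by fun_prop : Continuous fun s => (s, s - η))
    exact hκ1.intervalIntegrable.mul_continuousOn this.continuousOn
  eq_add x hx := by
    have := h.integral_mul_left hκ1 (w := fun _ => 1) continuous_const hx.1
    simp only [one_mul] at this
    simp only [leftPrimitive, rightPrimitive, intervalIntegral.integral_same, mul_zero, zero_add]
    rw [this, ← intervalIntegral.integral_const_mul]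
    congr 1; ext s
    rw [intervalIntegral.integral_comp_sub_left (fun z => goursatRight κ c s z) s, sub_self]; ring

/-- Along the characteristic `ξ = const`, the primitive of `b` solves the same equation as `b`. -/
lemma isPrimitiveOn_rightPrimitive (h : IsGoursatPair κ a c) (hκ1 : Integrable κ) {ξ : ℝ}
    (hξ : 0 ≤ ξ) (X : ℝ) :
    IsPrimitiveOn ξ X (fun x => rightPrimitive κ c x ξ)
      (fun s => κ s * leftPrimitive a s (s - ξ)) where
  integrable := by
    have : Continuous fun s => leftPrimitive a s (s - ξ) :=
      (continuous_leftPrimitive h.continuous_left).comp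
        (by fun_prop : Continuous fun s => (s, s - ξ))
    exact hκ1.intervalIntegrable.mul_continuousOn this.continuousOn
  eq_add x hx := by
    have hac : Continuous fun p : ℝ × ℝ => a p.1 (p.1 - p.2) :=
      h.continuous_left.comp (by fun_prop : Continuous fun p : ℝ × ℝ => (p.1, p.1 - p.2))
    have hi (y : ℝ) (S : Set ℝ) (hS : S ⊆ Icc y x) :
        IntegrableOn (fun s => κ s * a s (s - y)) S := by
      have hc : Continuous fun s => a s (s - y) :=
        hac.comp (by fun_prop : Continuous fun s => (s, y))
      exact (hκ1.integrableOn.mul_continuousOn hc.continuousOn isCompact_Icc).mono_set hS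
    have hdiff (y : ℝ) (hy : y ∈ uIcc 0 ξ) :
        c x y - c ξ y = ∫ s in ξ..x, κ s * a s (s - y) := by
      rw [uIcc_of_le hξ] at hy
      rw [h.right_eq, h.right_eq, ← Ioc_union_Ioc_eq_Ioc hy.2 hx.1, setIntegral_union
        (Ioc_disjoint_Ioc_of_le le_rfl) measurableSet_Ioc, intervalIntegral.integral_of_le hx.1,
        add_sub_cancel_left]
      · exact hi _ _ (Ioc_subset_Icc_self.trans (Icc_subset_Icc_right hx.1))
      · exact hi _ _ (Ioc_subset_Icc_self.trans (Icc_subset_Icc_left hy.2))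
    have hswap := intervalIntegral_intervalIntegral_swap
      (F := fun y s => κ s * a s (s - y)) (a := 0) (b := ξ) (c := ξ) (d := x) (by
        rw [uIoc_of_le hξ, uIoc_of_le hx.1]
        have := integrableOn_mul_of_continuous hκ1 (H := fun s z => a s (s - z))
          hac ξ x 0 ξ
        rw [IntegrableOn, Measure.volume_eq_prod, ← Measure.prod_restrict] at this ⊢
        exact this.swap)
    rw [← intervalIntegral.integral_congr hdiff, intervalIntegral.integral_sub
      ((h.continuous_right_apply x).intervalIntegrable _ _)
      ((h.continuous_right_apply ξ).intervalIntegrable _ _)] at hswap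
    have hR : (∫ s in ξ..x, κ s * leftPrimitive a s (s - ξ)) =
        2 * ∫ s in ξ..x, ∫ y in (0 : ℝ)..ξ, κ s * a s (s - y) := by
      rw [← intervalIntegral.integral_const_mul]
      congr 1; ext s
      rw [intervalIntegral.integral_const_mul,
        intervalIntegral.integral_comp_sub_left (fun z => a s z) s, sub_zero, leftPrimitive]
      ring
    rw [hR, ← hswap]
    simp only [rightPrimitive, goursatRight]
    rw [intervalIntegral.integral_add (hκ1.div_const 2).intervalIntegrable
        ((h.continuous_right_apply x).intervalIntegrable _ _),
      intervalIntegral.integral_add (hκ1.div_const 2).intervalIntegrable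
        ((h.continuous_right_apply ξ).intervalIntegrable _ _)]
    ring

end IsGoursatPair

/-! ### The solution generated by a Goursat pair -/

lemma HasSobolevDeriv.isPrimitiveOn {ℓ : ℝ} (hℓ : 0 ≤ ℓ) {u g : ℝ → ℂ}
    (h : HasSobolevDeriv ℓ u g) : IsPrimitiveOn 0 ℓ u g := by
  refine ⟨?_, h.2⟩
  rw [intervalIntegrable_iff_integrableOn_Ioo_of_le hℓ]
  exact h.1.integrable (by norm_num)

lemma memLp_two_of_continuousOn {ℓ : ℝ} {u : ℝ → ℂ} (hu : ContinuousOn u (Icc 0 ℓ)) :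
    MemLp u 2 (volume.restrict (Ioo 0 ℓ)) := by
  obtain ⟨C, hC⟩ := isCompact_Icc.exists_bound_of_continuousOn hu
  refine MemLp.of_bound ((hu.mono Ioo_subset_Icc_self).aestronglyMeasurable measurableSet_Ioo) C ?_
  exact (ae_restrict_iff' measurableSet_Ioo).2
    (Filter.Eventually.of_forall fun x hx => hC x (Ioo_subset_Icc_self hx))

lemma memLp_two_mul_of_continuousOn {ℓ : ℝ} {κ u : ℝ → ℂ} (hκ : MemLp κ 2)
    (hu : ContinuousOn u (Icc 0 ℓ)) :
    MemLp (fun x => κ x * u x) 2 (volume.restrict (Ioo 0 ℓ)) := by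
  obtain ⟨C, hC⟩ := isCompact_Icc.exists_bound_of_continuousOn hu
  refine (hκ.restrict _).of_le_mul (c := C) ((hκ.restrict _).aestronglyMeasurable.mul
    ((hu.mono Ioo_subset_Icc_self).aestronglyMeasurable measurableSet_Ioo)) ?_
  refine (ae_restrict_iff' measurableSet_Ioo).2 (Filter.Eventually.of_forall fun x hx => ?_)
  rw [norm_mul, mul_comm]
  gcongr
  exact hC x (Ioo_subset_Icc_self hx)

/-- The amplitude `p` of the right-going wave: `e^{iρx} p(x)` is the transform
`e^{iρx} + ∫ a e^{iρt} dt`, where the integral is over the slice `|t| < x`. -/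
def rightWave (a : ℝ → ℝ → ℂ) (ρ : ℂ) (x : ℝ) : ℂ :=
  1 + 2 * ∫ y in (0 : ℝ)..x, Complex.exp (-(2 * Complex.I * ρ * y)) * a x y

/-- The amplitude `q` of the left-going wave: `e^{-iρx} q(x)` is the transform `∫ b e^{iρt} dt`
over the slice `|t| < x`. -/
def leftWave (κ : ℝ → ℂ) (c : ℝ → ℝ → ℂ) (ρ : ℂ) (x : ℝ) : ℂ :=
  2 * ∫ y in (0 : ℝ)..x, Complex.exp (2 * Complex.I * ρ * y) * goursatRight κ c x y

lemma continuous_rightWave {a : ℝ → ℝ → ℂ} (ha : Continuous (Function.uncurry a)) (ρ : ℂ) :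
    Continuous (rightWave a ρ) := by
  have := (continuous_integral_mul_left ha
    (w := fun y => Complex.exp (-(2 * Complex.I * ρ * y))) (by fun_prop)).comp
    (by fun_prop : Continuous fun x : ℝ => (x, (0 : ℝ)))
  exact continuous_const.add (continuous_const.mul this)

lemma continuous_leftWave {κ : ℝ → ℂ} {c : ℝ → ℝ → ℂ} (hκ1 : Integrable κ)
    (hc : Continuous (Function.uncurry c)) (ρ : ℂ) : Continuous (leftWave κ c ρ) := by
  have := (continuous_integral_mul_goursatRight hκ1 hc
    (w := fun y => Complex.exp (2 * Complex.I * ρ * y)) (by fun_prop)).comp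
    (by fun_prop : Continuous fun x : ℝ => (x, x))
  exact continuous_const.mul this

namespace IsGoursatPair

variable {κ : ℝ → ℂ} {a c : ℝ → ℝ → ℂ}

lemma isPrimitiveOn_rightWave (h : IsGoursatPair κ a c) (hκ1 : Integrable κ) (ρ : ℂ) (X : ℝ) :
    IsPrimitiveOn 0 X (rightWave a ρ)
      (fun s => κ s * (Complex.exp (-(2 * Complex.I * ρ * s)) * leftWave κ c ρ s)) where
  integrable := by
    have := continuous_leftWave hκ1 h.continuous_right ρ
    exact hκ1.intervalIntegrable.mul_continuousOn (by fun_prop)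
  eq_add x hx := by
    simp only [rightWave, intervalIntegral.integral_same, mul_zero, add_zero]
    rw [h.integral_mul_left hκ1 (by fun_prop) hx.1, ← intervalIntegral.integral_const_mul]
    congr 2; ext s
    have hsub := intervalIntegral.integral_comp_sub_left (a := 0) (b := s)
      (fun z : ℝ => Complex.exp (-(2 * Complex.I * ρ * (s - z : ℝ))) * goursatRight κ c s z) s
    simp only [sub_sub_cancel, sub_zero, sub_self] at hsub
    rw [hsub, leftWave, mul_left_comm, mul_left_comm (Complex.exp _) (2 : ℂ),
      ← intervalIntegral.integral_const_mul (Complex.exp _)]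
    congr 3; ext z
    rw [← mul_assoc, ← Complex.exp_add]
    congr 2
    push_cast; ring

lemma isPrimitiveOn_leftWave (h : IsGoursatPair κ a c) (hκ1 : Integrable κ) (ρ : ℂ) (X : ℝ) :
    IsPrimitiveOn 0 X (leftWave κ c ρ)
      (fun s => κ s * (Complex.exp (2 * Complex.I * ρ * s) * rightWave a ρ s)) where
  integrable := by
    have := continuous_rightWave h.continuous_left ρ
    exact hκ1.intervalIntegrable.mul_continuousOn (by fun_prop)
  eq_add x hx := by
    have hi1 : IntervalIntegrable (fun s => κ s * Complex.exp (2 * Complex.I * ρ * s)) volume 0 x :=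
      hκ1.intervalIntegrable.mul_continuousOn (by fun_prop)
    have hcx := h.continuous_right_apply x
    have hi2 : IntervalIntegrable (fun s => Complex.exp (2 * Complex.I * ρ * s) * c x s)
      volume 0 x := (by fun_prop : Continuous _).intervalIntegrable _ _
    have hL : leftWave κ c ρ x = (∫ s in (0 : ℝ)..x, κ s * Complex.exp (2 * Complex.I * ρ * s)) +
        2 * ∫ s in (0 : ℝ)..x, Complex.exp (2 * Complex.I * ρ * s) * c x s := by
      rw [leftWave, ← intervalIntegral.integral_const_mul, ← intervalIntegral.integral_const_mul,
        ← intervalIntegral.integral_add hi1 (hi2.const_mul 2)]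
      congr 1; ext s
      simp only [goursatRight]; ring
    have hJ (s : ℝ) : κ s * (Complex.exp (2 * Complex.I * ρ * s) * rightWave a ρ s) =
        κ s * Complex.exp (2 * Complex.I * ρ * s) + 2 * (κ s *
          ∫ y in (0 : ℝ)..s, Complex.exp (2 * Complex.I * ρ * y) * a s (s - y)) := by
      have hsub := intervalIntegral.integral_comp_sub_left (a := 0) (b := s)
        (fun z : ℝ => Complex.exp (2 * Complex.I * ρ * (s - z : ℝ)) * a s z) s
      simp only [sub_sub_cancel, sub_zero, sub_self] at hsub
      have : (∫ z in (0 : ℝ)..s, Complex.exp (2 * Complex.I * ρ * (s - z : ℝ)) * a s z) =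
          Complex.exp (2 * Complex.I * ρ * s) *
            ∫ y in (0 : ℝ)..s, Complex.exp (-(2 * Complex.I * ρ * y)) * a s y := by
        rw [← intervalIntegral.integral_const_mul]
        congr 1; ext z
        rw [← mul_assoc, ← Complex.exp_add]
        congr 2
        push_cast; ring
      rw [hsub, this, rightWave]; ring
    have h0 : leftWave κ c ρ 0 = 0 := by simp [leftWave]
    have hcont := continuous_rightWave h.continuous_left ρ
    have hi3 : IntervalIntegrable (fun s => κ s *
        (Complex.exp (2 * Complex.I * ρ * s) * rightWave a ρ s)) volume 0 x :=
      hκ1.intervalIntegrable.mul_continuousOn (by fun_prop)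
    have hi4 : IntervalIntegrable (fun s => 2 * (κ s *
          ∫ y in (0 : ℝ)..s, Complex.exp (2 * Complex.I * ρ * y) * a s (s - y))) volume 0 x := by
      refine (hi3.sub hi1).congr_ae (Filter.Eventually.of_forall fun s => ?_)
      simp only [hJ]; ring
    rw [h0, zero_add, hL, h.integral_mul_right hκ1 (by fun_prop) hx.1]
    simp_rw [hJ]
    rw [intervalIntegral.integral_add hi1 hi4, intervalIntegral.integral_const_mul]

end IsGoursatPair

/-- The sum `S` of the right-going and the left-going wave. The solution `ê_f(ρ, ·)` is
`(f(0) / f) S`. -/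
def waveSum (κ : ℝ → ℂ) (a c : ℝ → ℝ → ℂ) (ρ : ℂ) (x : ℝ) : ℂ :=
  Complex.exp (Complex.I * ρ * x) * rightWave a ρ x +
    Complex.exp (-(Complex.I * ρ * x)) * leftWave κ c ρ x

/-- The difference `D` of the right-going and the left-going wave. The derivative of `ê_f(ρ, ·)`
is `iρ (f(0) / f) D`. -/
def waveDiff (κ : ℝ → ℂ) (a c : ℝ → ℝ → ℂ) (ρ : ℂ) (x : ℝ) : ℂ :=
  Complex.exp (Complex.I * ρ * x) * rightWave a ρ x -
    Complex.exp (-(Complex.I * ρ * x)) * leftWave κ c ρ x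

lemma isPrimitiveOn_exp (z : ℂ) (a b : ℝ) :
    IsPrimitiveOn a b (fun x : ℝ => Complex.exp (z * x)) (fun x : ℝ => z * Complex.exp (z * x)) := by
  refine IsPrimitiveOn.of_hasDerivAt (fun x => ?_) (by fun_prop)
  have h1 : HasDerivAt (fun y : ℂ => Complex.exp (z * y)) (z * Complex.exp (z * x)) x := by
    simpa [mul_comm] using ((hasDerivAt_id (x : ℂ)).const_mul z).cexp
  exact h1.comp_ofReal

lemma exp_two_mul (z : ℂ) (x : ℝ) : Complex.exp (-(Complex.I * z * x)) *
    Complex.exp (2 * Complex.I * z * x) = Complex.exp (Complex.I * z * x) := by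
  rw [← Complex.exp_add]; ring_nf

lemma exp_neg_two_mul (z : ℂ) (x : ℝ) : Complex.exp (Complex.I * z * x) *
    Complex.exp (-(2 * Complex.I * z * x)) = Complex.exp (-(Complex.I * z * x)) := by
  rw [← Complex.exp_add]; ring_nf

lemma waveSum_zero (κ : ℝ → ℂ) (a c : ℝ → ℝ → ℂ) (ρ : ℂ) : waveSum κ a c ρ 0 = 1 := by
  simp [waveSum, rightWave, leftWave]

lemma waveDiff_zero (κ : ℝ → ℂ) (a c : ℝ → ℝ → ℂ) (ρ : ℂ) : waveDiff κ a c ρ 0 = 1 := by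
  simp [waveDiff, rightWave, leftWave]

lemma isPrimitiveOn_inv {κ f : ℝ → ℂ} {ℓ : ℝ} (hℓ : 0 ≤ ℓ) (hf : IsPrimitiveOn 0 ℓ f fun x => κ x * f x)
    (hf0 : ∀ x ∈ Icc 0 ℓ, f x ≠ 0) :
    IsPrimitiveOn 0 ℓ (fun x => (f x)⁻¹) (fun x => -κ x * (f x)⁻¹) := by
  refine (hf.inv hℓ hf0).congr_deriv hℓ (Filter.Eventually.of_forall fun x hx => ?_)
  have := hf0 x (Ioc_subset_Icc_self hx)
  field_simp

namespace IsGoursatPair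

variable {κ : ℝ → ℂ} {a c : ℝ → ℝ → ℂ} {f : ℝ → ℂ} {ℓ : ℝ}

/-- Sum and difference of the waves solve the Dirac system
`S' = iρ D + κ S`, `D' = iρ S - κ D`. -/
lemma isPrimitiveOn_wave (h : IsGoursatPair κ a c) (hκ1 : Integrable κ) (hℓ : 0 ≤ ℓ) (ρ : ℂ) :
    IsPrimitiveOn 0 ℓ (waveSum κ a c ρ)
      (fun x => Complex.I * ρ * waveDiff κ a c ρ x + κ x * waveSum κ a c ρ x) ∧
    IsPrimitiveOn 0 ℓ (waveDiff κ a c ρ)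
      (fun x => Complex.I * ρ * waveSum κ a c ρ x - κ x * waveDiff κ a c ρ x) := by
  have hR := (isPrimitiveOn_exp (Complex.I * ρ) 0 ℓ).mul hℓ (h.isPrimitiveOn_rightWave hκ1 ρ ℓ)
  have hL := (isPrimitiveOn_exp (-(Complex.I * ρ)) 0 ℓ).mul hℓ (h.isPrimitiveOn_leftWave hκ1 ρ ℓ)
  simp only [neg_mul] at hL
  constructor
  · refine (hR.add hL).congr_deriv hℓ (Filter.Eventually.of_forall fun x _ => ?_)
    simp only [waveSum, waveDiff]
    linear_combination (κ x * leftWave κ c ρ x) * exp_neg_two_mul ρ x +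
      (κ x * rightWave a ρ x) * exp_two_mul ρ x
  · refine (hR.sub hL).congr_deriv hℓ (Filter.Eventually.of_forall fun x _ => ?_)
    simp only [waveSum, waveDiff]
    linear_combination (κ x * leftWave κ c ρ x) * exp_neg_two_mul ρ x -
      (κ x * rightWave a ρ x) * exp_two_mul ρ x

/-- `f⁻¹ S` is a primitive of `iρ f⁻¹ D`: the logarithmic derivative of `f` is `κ`. -/
lemma isPrimitiveOn_inv_mul_waveSum (h : IsGoursatPair κ a c) (hκ1 : Integrable κ) (hℓ : 0 ≤ ℓ)
    (hf : IsPrimitiveOn 0 ℓ f fun x => κ x * f x) (hf0 : ∀ x ∈ Icc 0 ℓ, f x ≠ 0) (ρ : ℂ) :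
    IsPrimitiveOn 0 ℓ (fun x => (f x)⁻¹ * waveSum κ a c ρ x)
      (fun x => Complex.I * ρ * ((f x)⁻¹ * waveDiff κ a c ρ x)) := by
  refine ((isPrimitiveOn_inv hℓ hf hf0).mul hℓ (h.isPrimitiveOn_wave hκ1 hℓ ρ).1).congr_deriv hℓ
    (Filter.Eventually.of_forall fun x _ => ?_)
  ring

/-- For `ρ = 0` the solution is constant. -/
lemma waveSum_zero_right (h : IsGoursatPair κ a c) (hκ1 : Integrable κ) (hℓ : 0 ≤ ℓ)
    (hf : IsPrimitiveOn 0 ℓ f fun x => κ x * f x) (hf0 : ∀ x ∈ Icc 0 ℓ, f x ≠ 0) {x : ℝ}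
    (hx : x ∈ Icc 0 ℓ) : waveSum κ a c 0 x = f x / f 0 := by
  have := (h.isPrimitiveOn_inv_mul_waveSum hκ1 hℓ hf hf0 0).eq_add x hx
  simp only [mul_zero, zero_mul, intervalIntegral.integral_zero, add_zero, waveSum_zero,
    mul_one] at this
  have h1 := hf0 x hx
  have h0 := hf0 0 ⟨le_rfl, hℓ⟩
  field_simp at this ⊢
  linear_combination this

/-- A Goursat pair for `κ = f' / f` generates the solutions of the impedance equation of `f`. -/
theorem isImpedanceExp (h : IsGoursatPair κ a c) (hκ : MemLp κ 2) (hκ1 : Integrable κ)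
    (hℓ : 0 ≤ ℓ) (hf : IsPrimitiveOn 0 ℓ f fun x => κ x * f x) (hf0 : ∀ x ∈ Icc 0 ℓ, f x ≠ 0)
    (ρ : ℂ) : IsImpedanceExp ℓ f ρ fun x => f 0 * ((f x)⁻¹ * waveSum κ a c ρ x) := by
  have hS := (h.isPrimitiveOn_wave hκ1 hℓ ρ).1
  have hD := (h.isPrimitiveOn_wave hκ1 hℓ ρ).2
  have hr := isPrimitiveOn_inv hℓ hf hf0
  have hv := h.isPrimitiveOn_inv_mul_waveSum hκ1 hℓ hf hf0 ρ
  have cS := hS.continuousOn hℓ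
  have cD := hD.continuousOn hℓ
  have cr := hr.continuousOn hℓ
  have cf := hf.continuousOn hℓ
  have hrD : IsPrimitiveOn 0 ℓ (fun x => (f x)⁻¹ * waveDiff κ a c ρ x)
      (fun x => Complex.I * ρ * ((f x)⁻¹ * waveSum κ a c ρ x) +
        κ x * (-2 * ((f x)⁻¹ * waveDiff κ a c ρ x))) := by
    refine (hr.mul hℓ hD).congr_deriv hℓ (Filter.Eventually.of_forall fun x _ => ?_)
    ring
  have hfD : IsPrimitiveOn 0 ℓ (fun x => f x * waveDiff κ a c ρ x)
      (fun x => Complex.I * ρ * (f x * waveSum κ a c ρ x)) := by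
    refine (hf.mul hℓ hD).congr_deriv hℓ (Filter.Eventually.of_forall fun x _ => ?_)
    ring
  have h0 := hf0 0 ⟨le_rfl, hℓ⟩
  refine ⟨fun x => f 0 * (Complex.I * ρ * ((f x)⁻¹ * waveDiff κ a c ρ x)),
    fun x => f 0 * (Complex.I * ρ * (Complex.I * ρ * ((f x)⁻¹ * waveSum κ a c ρ x) +
        κ x * (-2 * ((f x)⁻¹ * waveDiff κ a c ρ x)))),
    fun x => f 0 * (Complex.I * ρ * (Complex.I * ρ * (f x * waveSum κ a c ρ x))),
    ⟨memLp_two_of_continuousOn (by fun_prop), (hv.const_mul _).eq_add⟩,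
    ⟨(((memLp_two_of_continuousOn (by fun_prop)).add
      (memLp_two_mul_of_continuousOn hκ (by fun_prop))).const_mul _).const_mul _,
      ((hrD.const_mul _).const_mul _).eq_add⟩,
    ⟨memLp_two_of_continuousOn (by fun_prop), ?_⟩, ?_, ?_, ?_⟩
  · refine (((hfD.const_mul (Complex.I * ρ)).const_mul (f 0)).congr_fun fun x hx => ?_).eq_add
    have := hf0 x hx
    field_simp
  · refine (ae_restrict_iff' measurableSet_Ioo).2 (Filter.Eventually.of_forall fun x hx => ?_)
    have := hf0 x (Ioo_subset_Icc_self hx)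
    field_simp
    linear_combination (-ρ ^ 2 * waveSum κ a c ρ x) * Complex.I_sq
  · simp only [waveSum_zero]
    field_simp
  · simp only [waveDiff_zero]
    field_simp

/-! ### The kernel generated by a Goursat pair -/

lemma isPrimitiveOn_leftPrimitive_slice (h : IsGoursatPair κ a c) (x t₀ t₁ : ℝ) :
    IsPrimitiveOn t₀ t₁ (fun t => leftPrimitive a x ((x - t) / 2))
      (fun t => a x ((x - t) / 2)) where
  integrable := ((h.continuous_left_apply x).comp
    (by fun_prop : Continuous fun t : ℝ => (x - t) / 2)).intervalIntegrable _ _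
  eq_add t _ := by
    have hi (y z : ℝ) := (h.continuous_left_apply x).intervalIntegrable (μ := volume) y z
    have := intervalIntegral.integral_comp_sub_div (a := t₀) (b := t) (fun y => a x y)
      (two_ne_zero (α := ℝ)) (x / 2)
    simp only [sub_div]
    rw [this, leftPrimitive, leftPrimitive, ← intervalIntegral.integral_add_adjacent_intervals
      (hi (x / 2 - t / 2) (x / 2 - t₀ / 2)) (hi _ x), Complex.real_smul]
    push_cast; ring

lemma isPrimitiveOn_rightPrimitive_slice (h : IsGoursatPair κ a c) (hκ1 : Integrable κ)
    (x t₀ t₁ : ℝ) :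
    IsPrimitiveOn t₀ t₁ (fun t => rightPrimitive κ c x ((x + t) / 2))
      (fun t => goursatRight κ c x ((x + t) / 2)) where
  integrable := by
    have h1 : Integrable fun t => κ ((x + t) / 2) / 2 :=
      ((hκ1.comp_div two_ne_zero).comp_add_left x).div_const 2
    exact h1.intervalIntegrable.add (((h.continuous_right_apply x).comp
      (by fun_prop : Continuous fun t : ℝ => (x + t) / 2)).intervalIntegrable _ _)
  eq_add t _ := by
    have hi := intervalIntegrable_goursatRight hκ1 h.continuous_right x
    have := intervalIntegral.integral_comp_add_div (a := t₀) (b := t)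
      (fun y => goursatRight κ c x y) (two_ne_zero (α := ℝ)) (x / 2)
    simp only [add_div]
    rw [this, rightPrimitive, rightPrimitive, ← intervalIntegral.integral_add_adjacent_intervals
      (hi 0 (x / 2 + t₀ / 2)) (hi _ _), Complex.real_smul]
    push_cast; ring

/-- The transform of the pair over a slice, in terms of the waves. -/
lemma waveSum_eq (h : IsGoursatPair κ a c) (hκ1 : Integrable κ) (ρ : ℂ) (x : ℝ) :
    waveSum κ a c ρ x = Complex.exp (Complex.I * ρ * x) + ∫ t in (-x)..x,
      (a x ((x - t) / 2) + goursatRight κ c x ((x + t) / 2)) *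
        Complex.exp (Complex.I * ρ * t) := by
  have hexp : Continuous fun t : ℝ => Complex.exp (Complex.I * ρ * t) := by fun_prop
  have e1 := intervalIntegral.integral_comp_sub_div (a := -x) (b := x)
    (fun y : ℝ => Complex.exp (Complex.I * ρ * (x - 2 * y : ℝ)) * a x y)
    (two_ne_zero (α := ℝ)) (x / 2)
  have e2 := intervalIntegral.integral_comp_add_div (a := -x) (b := x)
    (fun y : ℝ => Complex.exp (Complex.I * ρ * (2 * y - x : ℝ)) * goursatRight κ c x y)
    (two_ne_zero (α := ℝ)) (x / 2)
  have r1 (t : ℝ) : x - 2 * (x / 2 - t / 2) = t := by ring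
  have r2 (t : ℝ) : 2 * (x / 2 + t / 2) - x = t := by ring
  have r3 : x / 2 - -x / 2 = x := by ring
  have r4 : x / 2 + -x / 2 = 0 := by ring
  have r5 : x / 2 + x / 2 = x := by ring
  simp only [r1, r2, r3, r4, r5, sub_self, Complex.real_smul] at e1 e2
  simp only [add_mul]
  rw [intervalIntegral.integral_add
    ((h.isPrimitiveOn_leftPrimitive_slice x (-x) x).integrable.mul_continuousOn
      hexp.continuousOn)
    ((h.isPrimitiveOn_rightPrimitive_slice hκ1 x (-x) x).integrable.mul_continuousOn
      hexp.continuousOn)]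
  simp only [sub_div, add_div, mul_comm _ (Complex.exp _)]
  rw [e1, e2, waveSum, rightWave, leftWave, mul_add, mul_one, mul_left_comm _ (2 : ℂ),
    mul_left_comm _ (2 : ℂ), ← intervalIntegral.integral_const_mul (Complex.exp _),
    ← intervalIntegral.integral_const_mul (Complex.exp _), add_assoc, Complex.ofReal_ofNat]
  have x1 (y : ℝ) : Complex.exp (Complex.I * ρ * x) * (Complex.exp (-(2 * Complex.I * ρ * y)) *
      a x y) = Complex.exp (Complex.I * ρ * (x - 2 * y : ℝ)) * a x y := by
    rw [← mul_assoc, ← Complex.exp_add]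
    congr 2; push_cast; ring
  have x2 (y : ℝ) : Complex.exp (-(Complex.I * ρ * x)) * (Complex.exp (2 * Complex.I * ρ * y) *
      goursatRight κ c x y) =
      Complex.exp (Complex.I * ρ * (2 * y - x : ℝ)) * goursatRight κ c x y := by
    rw [← mul_assoc, ← Complex.exp_add]
    congr 2; push_cast; ring
  simp only [x1, x2]

end IsGoursatPair

/-- The kernel `K(x, t) = (f(0) / f(x)) ∫ (a + b)(x, τ) dτ`, with integration over `-x < τ < t`. -/
def goursatKernel (f κ : ℝ → ℂ) (a c : ℝ → ℝ → ℂ) (p : ℝ × ℝ) : ℂ :=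
  f 0 * ((f p.1)⁻¹ * (leftPrimitive a p.1 ((p.1 - p.2) / 2) +
    rightPrimitive κ c p.1 ((p.1 + p.2) / 2)))

namespace IsGoursatPair

variable {κ : ℝ → ℂ} {a c : ℝ → ℝ → ℂ} {f : ℝ → ℂ} {ℓ : ℝ}

/-- Integration by parts on a slice turns the transform of `a + b` into that of its primitive. The
boundary term at `t = x` is evaluated with the case `ρ = 0`. -/
theorem exp_sub_integral_goursatKernel (h : IsGoursatPair κ a c) (hκ1 : Integrable κ) (hℓ : 0 ≤ ℓ)
    (hf : IsPrimitiveOn 0 ℓ f fun x => κ x * f x) (hf0 : ∀ x ∈ Icc 0 ℓ, f x ≠ 0) (ρ : ℂ) {x : ℝ}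
    (hx : x ∈ Icc 0 ℓ) :
    f 0 * ((f x)⁻¹ * waveSum κ a c ρ x) = Complex.exp (Complex.I * ρ * x) - Complex.I * ρ *
      ∫ t in (-x)..x, goursatKernel f κ a c (x, t) * Complex.exp (Complex.I * ρ * t) := by
  have hx0 : -x ≤ x := by linarith [hx.1]
  have hP := (h.isPrimitiveOn_leftPrimitive_slice x (-x) x).add
    (h.isPrimitiveOn_rightPrimitive_slice hκ1 x (-x) x)
  have hE := isPrimitiveOn_exp (Complex.I * ρ) (-x) x
  have hmul := (hP.mul hx0 hE).sub_eq ⟨le_rfl, hx0⟩ ⟨hx0, le_rfl⟩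
  have hcP := hP.continuousOn hx0
  have hcE := hE.continuousOn hx0
  rw [← uIcc_of_le hx0] at hcP hcE
  have hend : leftPrimitive a x ((x - -x) / 2) + rightPrimitive κ c x ((x + -x) / 2) = 0 := by
    have r1 : (x - -x) / 2 = x := by ring
    have r2 : (x + -x) / 2 = 0 := by ring
    rw [r1, r2]; simp [leftPrimitive, rightPrimitive]
  rw [hend, zero_mul, sub_zero, intervalIntegral.integral_add (hP.integrable.mul_continuousOn hcE)
    (hE.integrable.continuousOn_mul hcP)] at hmul
  have hS := h.waveSum_eq hκ1 ρ x
  have hS0 := h.waveSum_eq hκ1 0 x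
  rw [h.waveSum_zero_right hκ1 hℓ hf hf0 hx] at hS0
  simp only [mul_zero, zero_mul, Complex.exp_zero, mul_one] at hS0
  have hPx := hP.sub_eq ⟨le_rfl, hx0⟩ ⟨hx0, le_rfl⟩
  rw [hend, sub_zero] at hPx
  rw [← hPx] at hS0
  generalize leftPrimitive a x ((x - x) / 2) + rightPrimitive κ c x ((x + x) / 2) = Q at hmul hS0
  have hK : (∫ t in (-x)..x, goursatKernel f κ a c (x, t) * Complex.exp (Complex.I * ρ * t)) =
      f 0 * (f x)⁻¹ * ∫ t in (-x)..x, (leftPrimitive a x ((x - t) / 2) +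
        rightPrimitive κ c x ((x + t) / 2)) * Complex.exp (Complex.I * ρ * t) := by
    rw [← intervalIntegral.integral_const_mul]
    congr 1; ext t
    simp only [goursatKernel]; ring
  have hI : (∫ t in (-x)..x, (leftPrimitive a x ((x - t) / 2) +
        rightPrimitive κ c x ((x + t) / 2)) * (Complex.I * ρ * Complex.exp (Complex.I * ρ * t))) =
      Complex.I * ρ * ∫ t in (-x)..x, (leftPrimitive a x ((x - t) / 2) +
        rightPrimitive κ c x ((x + t) / 2)) * Complex.exp (Complex.I * ρ * t) := by
    rw [← intervalIntegral.integral_const_mul]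
    congr 1; ext t; ring
  rw [hI] at hmul
  rw [hK, hS]
  have h0 := hf0 0 ⟨le_rfl, hℓ⟩
  have h1 := hf0 x hx
  field_simp at hS0 ⊢
  linear_combination (-f 0) * hmul - Complex.exp (Complex.I * ρ * x) * hS0

lemma continuousOn_goursatKernel (h : IsGoursatPair κ a c) (hκ1 : Integrable κ) (hℓ : 0 ≤ ℓ)
    (hf : IsPrimitiveOn 0 ℓ f fun x => κ x * f x) (hf0 : ∀ x ∈ Icc 0 ℓ, f x ≠ 0) :
    ContinuousOn (goursatKernel f κ a c) (closedTriangle ℓ) := by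
  have hr := (isPrimitiveOn_inv hℓ hf hf0).continuousOn hℓ
  have h1 : ContinuousOn (fun p : ℝ × ℝ => (f p.1)⁻¹) (closedTriangle ℓ) :=
    hr.comp continuous_fst.continuousOn fun p hp => ⟨hp.1, hp.2.1⟩
  have h2 : Continuous fun p : ℝ × ℝ => leftPrimitive a p.1 ((p.1 - p.2) / 2) :=
    (continuous_leftPrimitive h.continuous_left).comp
      (by fun_prop : Continuous fun p : ℝ × ℝ => (p.1, (p.1 - p.2) / 2))
  have h3 : Continuous fun p : ℝ × ℝ => rightPrimitive κ c p.1 ((p.1 + p.2) / 2) :=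
    (continuous_rightPrimitive hκ1 h.continuous_right).comp
      (by fun_prop : Continuous fun p : ℝ × ℝ => (p.1, (p.1 + p.2) / 2))
  exact continuousOn_const.mul (h1.mul (h2.add h3).continuousOn)

end IsGoursatPair

lemma measurableSet_triangle (ℓ : ℝ) : MeasurableSet (triangle ℓ) :=
  (measurableSet_lt measurable_const measurable_fst).inter
    ((measurableSet_lt measurable_fst measurable_const).inter
      (measurableSet_lt (by fun_prop) measurable_fst))

lemma triangle_subset_closedTriangle (ℓ : ℝ) : triangle ℓ ⊆ closedTriangle ℓ :=
  fun _ hp => ⟨hp.1.le, hp.2.1.le, hp.2.2.le⟩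

lemma isCompact_closedTriangle (ℓ : ℝ) : IsCompact (closedTriangle ℓ) := by
  refine (isCompact_Icc (a := ((0 : ℝ), -ℓ)) (b := (ℓ, ℓ))).of_isClosed_subset ?_ fun p hp => ?_
  · exact (isClosed_le continuous_const continuous_fst).inter
      ((isClosed_le continuous_fst continuous_const).inter
        (isClosed_le (by fun_prop) continuous_fst))
  · have := abs_le.1 hp.2.2
    exact ⟨⟨hp.1, by linarith [hp.2.1, this.1]⟩, ⟨hp.2.1, by linarith [hp.2.1, this.2]⟩⟩

instance (ℓ : ℝ) : IsFiniteMeasure (volume.restrict (triangle ℓ)) :=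
  ⟨by
    rw [Measure.restrict_apply_univ]
    exact (measure_mono (triangle_subset_closedTriangle ℓ)).trans_lt
      (isCompact_closedTriangle ℓ).measure_lt_top⟩

lemma memLp_triangle_of_continuousOn {ℓ : ℝ} {u : ℝ × ℝ → ℂ} {p : ENNReal}
    (hu : ContinuousOn u (closedTriangle ℓ)) : MemLp u p (volume.restrict (triangle ℓ)) := by
  obtain ⟨C, hC⟩ := (isCompact_closedTriangle ℓ).exists_bound_of_continuousOn hu
  refine MemLp.of_bound ((hu.mono (triangle_subset_closedTriangle ℓ)).aestronglyMeasurable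
    (measurableSet_triangle ℓ)) C ?_
  exact (ae_restrict_iff' (measurableSet_triangle ℓ)).2
    (Filter.Eventually.of_forall fun p hp => hC p (triangle_subset_closedTriangle ℓ hp))

/-- Existence of the impedance kernel. -/
theorem IsGoursatPair.isImpedanceKernel {κ : ℝ → ℂ} {a c : ℝ → ℝ → ℂ} {f : ℝ → ℂ} {ℓ : ℝ}
    (h : IsGoursatPair κ a c) (hκ : MemLp κ 2) (hκ1 : Integrable κ) (hℓ : 0 ≤ ℓ)
    (hf : IsPrimitiveOn 0 ℓ f fun x => κ x * f x) (hf0 : ∀ x ∈ Icc 0 ℓ, f x ≠ 0) :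
    IsImpedanceKernel ℓ f (goursatKernel f κ a c) := by
  refine ⟨memLp_triangle_of_continuousOn (h.continuousOn_goursatKernel hκ1 hℓ hf hf0),
    fun ρ => ⟨_, h.isImpedanceExp hκ hκ1 hℓ hf hf0 ρ, ?_⟩⟩
  exact (ae_restrict_iff' measurableSet_Ioo).2 (Filter.Eventually.of_forall fun x hx =>
    h.exp_sub_integral_goursatKernel hκ1 hℓ hf hf0 ρ (Ioo_subset_Icc_self hx))

/-! ### Weak directional derivatives -/

/-- The integrable function `g` is on `Ω` the weak derivative of the integrable function `u` in the
direction `e`. Square integrability is not required. -/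
structure IsWeakDirDeriv (Ω : Set (ℝ × ℝ)) (e : ℝ × ℝ) (u g : ℝ × ℝ → ℂ) : Prop where
  integrableOn_fun : IntegrableOn u Ω
  integrableOn_deriv : IntegrableOn g Ω
  integral_eq : ∀ φ : ℝ × ℝ → ℂ, ContDiff ℝ ∞ φ → HasCompactSupport φ → tsupport φ ⊆ Ω →
    ∫ p in Ω, u p * fderiv ℝ φ p e = -∫ p in Ω, g p * φ p

lemma integrableOn_mul_of_hasCompactSupport {Ω : Set (ℝ × ℝ)} {u ψ : ℝ × ℝ → ℂ}
    (hu : IntegrableOn u Ω) (hψ : Continuous ψ) (hψc : HasCompactSupport ψ) :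
    IntegrableOn (fun p => u p * ψ p) Ω := by
  obtain ⟨C, hC⟩ := hψc.exists_bound_of_continuous hψ
  exact Integrable.mul_bdd hu hψ.aestronglyMeasurable (Filter.Eventually.of_forall hC)

lemma continuous_fderiv_apply_of_contDiff {φ : ℝ × ℝ → ℂ} (hφ : ContDiff ℝ ∞ φ) (e : ℝ × ℝ) :
    Continuous fun p => fderiv ℝ φ p e :=
  (hφ.continuous_fderiv (by simp)).clm_apply continuous_const

lemma hasCompactSupport_fderiv_apply {φ : ℝ × ℝ → ℂ} (hφc : HasCompactSupport φ) (e : ℝ × ℝ) :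
    HasCompactSupport fun p => fderiv ℝ φ p e :=
  (hφc.fderiv (𝕜 := ℝ)).comp_left (g := fun L : ℝ × ℝ →L[ℝ] ℂ => L e) (by simp)

namespace IsWeakDirDeriv

variable {Ω : Set (ℝ × ℝ)} {e e' : ℝ × ℝ} {u v g h : ℝ × ℝ → ℂ}

lemma add (hu : IsWeakDirDeriv Ω e u g) (hv : IsWeakDirDeriv Ω e v h) :
    IsWeakDirDeriv Ω e (fun p => u p + v p) (fun p => g p + h p) where
  integrableOn_fun := hu.integrableOn_fun.add hv.integrableOn_fun
  integrableOn_deriv := hu.integrableOn_deriv.add hv.integrableOn_deriv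
  integral_eq φ h1 h2 h3 := by
    have hc := continuous_fderiv_apply_of_contDiff h1 e
    have hs := hasCompactSupport_fderiv_apply h2 e
    simp only [add_mul]
    rw [integral_add (integrableOn_mul_of_hasCompactSupport hu.integrableOn_fun hc hs)
        (integrableOn_mul_of_hasCompactSupport hv.integrableOn_fun hc hs),
      integral_add (integrableOn_mul_of_hasCompactSupport hu.integrableOn_deriv h1.continuous h2)
        (integrableOn_mul_of_hasCompactSupport hv.integrableOn_deriv h1.continuous h2),
      hu.integral_eq φ h1 h2 h3, hv.integral_eq φ h1 h2 h3]
    ring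

lemma const_mul (C : ℂ) (hu : IsWeakDirDeriv Ω e u g) :
    IsWeakDirDeriv Ω e (fun p => C * u p) (fun p => C * g p) where
  integrableOn_fun := hu.integrableOn_fun.const_mul C
  integrableOn_deriv := hu.integrableOn_deriv.const_mul C
  integral_eq φ h1 h2 h3 := by
    simp only [mul_assoc, integral_const_mul, hu.integral_eq φ h1 h2 h3, mul_neg]

lemma add_direction (hu : IsWeakDirDeriv Ω e u g) (hu' : IsWeakDirDeriv Ω e' u h) :
    IsWeakDirDeriv Ω (e + e') u (fun p => g p + h p) where
  integrableOn_fun := hu.integrableOn_fun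
  integrableOn_deriv := hu.integrableOn_deriv.add hu'.integrableOn_deriv
  integral_eq φ h1 h2 h3 := by
    simp only [add_mul, map_add, mul_add]
    rw [integral_add (integrableOn_mul_of_hasCompactSupport hu.integrableOn_fun
        (continuous_fderiv_apply_of_contDiff h1 e) (hasCompactSupport_fderiv_apply h2 e))
        (integrableOn_mul_of_hasCompactSupport hu.integrableOn_fun
        (continuous_fderiv_apply_of_contDiff h1 e') (hasCompactSupport_fderiv_apply h2 e')),
      integral_add (integrableOn_mul_of_hasCompactSupport hu.integrableOn_deriv h1.continuous h2)
        (integrableOn_mul_of_hasCompactSupport hu'.integrableOn_deriv h1.continuous h2),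
      hu.integral_eq φ h1 h2 h3, hu'.integral_eq φ h1 h2 h3]
    ring

lemma neg_direction (hu : IsWeakDirDeriv Ω e u g) :
    IsWeakDirDeriv Ω (-e) u (fun p => -g p) where
  integrableOn_fun := hu.integrableOn_fun
  integrableOn_deriv := hu.integrableOn_deriv.neg
  integral_eq φ h1 h2 h3 := by
    simp only [map_neg, mul_neg, neg_mul, integral_neg, hu.integral_eq φ h1 h2 h3]

lemma hasWeakDirDeriv (hu : IsWeakDirDeriv Ω e u g) (hg : MemLp g 2 (volume.restrict Ω)) :
    HasWeakDirDeriv Ω e u g :=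
  ⟨hg, hu.integral_eq⟩

/-- Absolute continuity on lines: if `u` is on every line in direction `e` a primitive of `g`, then
`g` is the weak derivative of `u` in direction `e`. The lines are parametrized by `x ↦ S (c, x)`
for a measure preserving map `S` of the plane. -/
theorem of_lines {S : ℝ × ℝ → ℝ × ℝ} (hS : MeasurePreserving S) (hSc : Continuous S)
    (hSi : Function.Injective S) (hSe : ∀ c x, S (c, x) = S (c, 0) + x • e) {R : ℝ}
    (hR : ∀ c x, S (c, x) ∈ Ω → |x| ≤ R) (hu : IntegrableOn u Ω) (hg : IntegrableOn g Ω)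
    (hline : ∀ c x₀ x₁, x₀ ≤ x₁ → S (c, x₀) ∈ Ω → S (c, x₁) ∈ Ω →
      IsPrimitiveOn x₀ x₁ (fun x => u (S (c, x))) (fun x => g (S (c, x)))) :
    IsWeakDirDeriv Ω e u g := by
  refine ⟨hu, hg, fun φ hφ hφc hφΩ => ?_⟩
  have hemb : MeasurableEmbedding S := hSc.measurable.measurableEmbedding hSi
  have hz1 (p : ℝ × ℝ) (hp : p ∉ tsupport φ) : φ p = 0 := image_eq_zero_of_notMem_tsupport hp
  have hz2 (p : ℝ × ℝ) (hp : p ∉ tsupport φ) : fderiv ℝ φ p e = 0 := by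
    have : fderiv ℝ φ p = 0 := by
      by_contra hne
      exact hp (support_fderiv_subset ℝ hne)
    simp [this]
  -- Both integrals are integrals over the plane, and there Fubini's theorem applies.
  have hfub (w ψ : ℝ × ℝ → ℂ) (hw : IntegrableOn w Ω) (hψ : Continuous ψ)
      (hψc : HasCompactSupport ψ) (hψ0 : ∀ p ∉ tsupport φ, ψ p = 0) :
      ∫ p in Ω, w p * ψ p = ∫ c : ℝ, ∫ x : ℝ, w (S (c, x)) * ψ (S (c, x)) := by
    have h0 (p : ℝ × ℝ) (hp : p ∉ Ω) : w p * ψ p = 0 := by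
      rw [hψ0 p fun h => hp (hφΩ h), mul_zero]
    have hint : Integrable fun p => w p * ψ p :=
      (integrableOn_iff_integrable_of_support_subset fun p hp => by
        by_contra hpΩ
        exact hp (h0 p hpΩ)).1 (integrableOn_mul_of_hasCompactSupport hw hψ hψc)
    rw [setIntegral_eq_integral_of_forall_compl_eq_zero h0,
      ← hS.integral_comp hemb (fun p => w p * ψ p)]
    exact integral_prod _ (hS.integrable_comp_of_integrable hint)
  rw [hfub _ _ hu (continuous_fderiv_apply_of_contDiff hφ e)
    (hasCompactSupport_fderiv_apply hφc e) hz2, hfub _ _ hg hφ.continuous hφc hz1, ← integral_neg]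
  congr 1; ext c
  set γ : ℝ → ℝ × ℝ := fun x => S (c, x) with hγ
  have hγc : Continuous γ := hSc.comp (by fun_prop)
  have hψd (x : ℝ) : HasDerivAt (fun x => φ (γ x)) (fderiv ℝ φ (γ x) e) x := by
    have h1 : HasDerivAt γ e x := by
      have : γ = fun x => S (c, 0) + x • e := by ext1 y; exact hSe c y
      rw [this]
      simpa using ((hasDerivAt_id x).smul_const e).const_add (S (c, 0))
    exact ((hφ.differentiable (by simp)) (γ x)).hasFDerivAt.comp_hasDerivAt x h1
  set T := γ ⁻¹' tsupport φ with hT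
  rcases T.eq_empty_or_nonempty with hTe | hTn
  · have hn (x : ℝ) : γ x ∉ tsupport φ := fun hx => (hTe ▸ hx : x ∈ (∅ : Set ℝ))
    have e1 : (fun x => u (γ x) * fderiv ℝ φ (γ x) e) = fun _ => 0 := by
      ext x; rw [hz2 _ (hn x), mul_zero]
    have e2 : (fun x => g (γ x) * φ (γ x)) = fun _ => 0 := by
      ext x; rw [hz1 _ (hn x), mul_zero]
    simp only [hγ] at e1 e2
    rw [e1, e2]; simp
  have hTcl : IsClosed T := (isClosed_tsupport φ).preimage hγc
  have hTc : IsCompact T := (isCompact_Icc (a := -R) (b := R)).of_isClosed_subset hTcl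
    fun x hx => abs_le.1 (hR c x (hφΩ hx))
  have h0 : sInf T ∈ T := hTc.sInf_mem hTn
  have h1 : sSup T ∈ T := hTc.sSup_mem hTn
  have h01 : sInf T ≤ sSup T := csInf_le hTc.bddBelow h1
  have hTI : T ⊆ Icc (sInf T) (sSup T) := fun x hx =>
    ⟨csInf_le hTc.bddBelow hx, le_csSup hTc.bddAbove hx⟩
  -- The test function vanishes at the ends of the smallest interval that contains its support.
  have hψ0 : IsClosed {x | φ (γ x) = 0} :=
    isClosed_eq (hφ.continuous.comp hγc) continuous_const
  have hza : φ (γ (sInf T)) = 0 := by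
    have : closure (Iio (sInf T)) ⊆ {x | φ (γ x) = 0} :=
      closure_minimal (fun x hx => hz1 _ fun h => (not_lt.2 (hTI h).1) hx) hψ0
    rw [closure_Iio] at this
    exact this (le_refl (sInf T))
  have hzb : φ (γ (sSup T)) = 0 := by
    have : closure (Ioi (sSup T)) ⊆ {x | φ (γ x) = 0} :=
      closure_minimal (fun x hx => hz1 _ fun h => (not_lt.2 (hTI h).2) hx) hψ0
    rw [closure_Ioi] at this
    exact this (le_refl (sSup T))
  have hparts := (hline c _ _ h01 (hφΩ h0) (hφΩ h1)).integral_mul_eq_neg h01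
    (IsPrimitiveOn.of_hasDerivAt hψd ((continuous_fderiv_apply_of_contDiff hφ e).comp hγc)) hza hzb
  have hres (w ψ : ℝ × ℝ → ℂ) (hψ0 : ∀ p ∉ tsupport φ, ψ p = 0) :
      ∫ x in sInf T..sSup T, w (γ x) * ψ (γ x) = ∫ x, w (γ x) * ψ (γ x) := by
    rw [intervalIntegral.integral_of_le h01, ← integral_Icc_eq_integral_Ioc]
    refine setIntegral_eq_integral_of_forall_compl_eq_zero fun x hx => ?_
    rw [hψ0 _ fun h => hx (hTI h), mul_zero]
  rw [hres u (fun p => fderiv ℝ φ p e) hz2, hres g φ hz1] at hparts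
  exact hparts

end IsWeakDirDeriv

/-! ### Weak derivatives of the kernel -/

lemma integrableOn_closedTriangle_comp_fst {κ : ℝ → ℂ} (hκ1 : Integrable κ) (ℓ : ℝ) :
    IntegrableOn (fun p : ℝ × ℝ => κ p.1) (closedTriangle ℓ) := by
  have h1 : IntegrableOn (fun p : ℝ × ℝ => κ p.1) (Icc 0 ℓ ×ˢ Icc (-ℓ) ℓ) := by
    rw [IntegrableOn, Measure.volume_eq_prod, ← Measure.prod_restrict]
    exact hκ1.integrableOn.comp_fst _
  refine h1.mono_set fun p hp => ?_
  have := abs_le.1 hp.2.2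
  exact ⟨⟨hp.1, hp.2.1⟩, by linarith [hp.2.1, this.1], by linarith [hp.2.1, this.2]⟩

/-- A square integrable function of the characteristic coordinate `(x + t) / 2` is square
integrable on the triangle. -/
lemma memLp_triangle_comp_add_div {κ : ℝ → ℂ} (hκ : MemLp κ 2) (ℓ : ℝ) :
    MemLp (fun p : ℝ × ℝ => κ ((p.1 + p.2) / 2)) 2 (volume.restrict (triangle ℓ)) := by
  have hk : MemLp (fun y => κ (y / 2)) 2 := by
    have hq : Measure.QuasiMeasurePreserving (fun y : ℝ => y / 2) volume volume := by
      refine ⟨by fun_prop, ?_⟩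
      have h2 : (fun y : ℝ => y / 2) = fun y => y * (2 : ℝ)⁻¹ := by ext y; rw [div_eq_mul_inv]
      rw [h2, Real.map_volume_mul_right (by norm_num)]
      exact Measure.smul_absolutelyContinuous
    have hm : AEStronglyMeasurable (fun y => κ (y / 2)) :=
      hκ.aestronglyMeasurable.comp_quasiMeasurePreserving hq
    rw [memLp_two_iff_integrable_sq_norm hm]
    exact ((memLp_two_iff_integrable_sq_norm hκ.aestronglyMeasurable).1 hκ).comp_div two_ne_zero
  have h1 : MemLp (fun p : ℝ × ℝ => κ (p.2 / 2)) 2 ((volume.restrict (Icc 0 ℓ)).prod volume) :=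
    hk.comp_snd _
  have h2 := h1.comp_measurePreserving (measurePreserving_prod_add (volume.restrict (Icc 0 ℓ))
    (volume : Measure ℝ))
  refine h2.mono_measure ?_
  have h3 : (volume.restrict (Icc 0 ℓ)).prod (volume : Measure ℝ) =
      volume.restrict (Icc 0 ℓ ×ˢ univ) := by
    rw [Measure.volume_eq_prod, ← Measure.prod_restrict, Measure.restrict_univ]
  rw [h3]
  exact Measure.restrict_mono
    (fun p hp => mk_mem_prod (show p.1 ∈ Icc 0 ℓ from ⟨hp.1.le, hp.2.1.le⟩) (mem_univ _)) le_rfl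

namespace IsGoursatPair

variable {κ : ℝ → ℂ} {a c : ℝ → ℝ → ℂ} {f : ℝ → ℂ} {ℓ : ℝ}

/-- Both partial derivatives of the kernel exist weakly. Each of the two primitives in the kernel
has a derivative in the direction `t` and another one along its own characteristics; in the
sum of the resulting derivatives in the direction `x` the terms with `κ` cancel. -/
theorem hasWeakDeriv_goursatKernel (h : IsGoursatPair κ a c) (hκ : MemLp κ 2)
    (hκ1 : Integrable κ) (hℓ : 0 ≤ ℓ) (hf : IsPrimitiveOn 0 ℓ f fun x => κ x * f x)
    (hf0 : ∀ x ∈ Icc 0 ℓ, f x ≠ 0) :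
    HasWeakDerivX (triangle ℓ) (goursatKernel f κ a c) (fun p => f 0 * ((f p.1)⁻¹ *
      (goursatRight κ c p.1 ((p.1 + p.2) / 2) - a p.1 ((p.1 - p.2) / 2)))) ∧
    HasWeakDerivT (triangle ℓ) (goursatKernel f κ a c) (fun p => f 0 * ((f p.1)⁻¹ *
      (a p.1 ((p.1 - p.2) / 2) + goursatRight κ c p.1 ((p.1 + p.2) / 2)))) := by
  have hr := isPrimitiveOn_inv hℓ hf hf0
  have hcr : ContinuousOn (fun p : ℝ × ℝ => (f p.1)⁻¹) (closedTriangle ℓ) :=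
    (hr.continuousOn hℓ).comp continuous_fst.continuousOn fun p hp => ⟨hp.1, hp.2.1⟩
  have hcM : Continuous fun p : ℝ × ℝ => leftPrimitive a p.1 ((p.1 - p.2) / 2) :=
    (continuous_leftPrimitive h.continuous_left).comp
      (by fun_prop : Continuous fun p : ℝ × ℝ => (p.1, (p.1 - p.2) / 2))
  have hcN : Continuous fun p : ℝ × ℝ => rightPrimitive κ c p.1 ((p.1 + p.2) / 2) :=
    (continuous_rightPrimitive hκ1 h.continuous_right).comp
      (by fun_prop : Continuous fun p : ℝ × ℝ => (p.1, (p.1 + p.2) / 2))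
  have hcA : Continuous fun p : ℝ × ℝ => a p.1 ((p.1 - p.2) / 2) :=
    h.continuous_left.comp (by fun_prop : Continuous fun p : ℝ × ℝ => (p.1, (p.1 - p.2) / 2))
  have hcC : Continuous fun p : ℝ × ℝ => c p.1 ((p.1 + p.2) / 2) :=
    h.continuous_right.comp (by fun_prop : Continuous fun p : ℝ × ℝ => (p.1, (p.1 + p.2) / 2))
  have hrA : MemLp (fun p : ℝ × ℝ => (f p.1)⁻¹ * a p.1 ((p.1 - p.2) / 2)) 2
      (volume.restrict (triangle ℓ)) :=
    memLp_triangle_of_continuousOn (hcr.mul hcA.continuousOn)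
  have hrB : MemLp (fun p : ℝ × ℝ => (f p.1)⁻¹ * goursatRight κ c p.1 ((p.1 + p.2) / 2)) 2
      (volume.restrict (triangle ℓ)) := by
    have hB : MemLp (fun p : ℝ × ℝ => goursatRight κ c p.1 ((p.1 + p.2) / 2)) 2
        (volume.restrict (triangle ℓ)) := by
      have h1 := (memLp_triangle_comp_add_div hκ ℓ).const_mul (2 : ℂ)⁻¹
      refine (h1.add (memLp_triangle_of_continuousOn hcC.continuousOn)).ae_eq
        (Filter.Eventually.of_forall fun p => ?_)
      simp only [goursatRight, Pi.add_apply]; ring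
    obtain ⟨C, hC⟩ := (isCompact_closedTriangle ℓ).exists_bound_of_continuousOn hcr
    refine hB.of_le_mul (c := C) (((hcr.mono (triangle_subset_closedTriangle ℓ)).aestronglyMeasurable
      (measurableSet_triangle ℓ)).mul hB.aestronglyMeasurable) ?_
    refine (ae_restrict_iff' (measurableSet_triangle ℓ)).2
      (Filter.Eventually.of_forall fun p hp => ?_)
    rw [norm_mul]
    gcongr
    exact hC p (triangle_subset_closedTriangle ℓ hp)
  have hiκ {w : ℝ × ℝ → ℂ} (hw : Continuous w) :
      IntegrableOn (fun p : ℝ × ℝ => κ p.1 * ((f p.1)⁻¹ * w p)) (triangle ℓ) :=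
    ((integrableOn_closedTriangle_comp_fst hκ1 ℓ).mul_continuousOn
      (hcr.mul hw.continuousOn) (isCompact_closedTriangle ℓ)).mono_set
      (triangle_subset_closedTriangle ℓ)
  have hiM : IntegrableOn (fun p : ℝ × ℝ => (f p.1)⁻¹ * leftPrimitive a p.1 ((p.1 - p.2) / 2))
      (triangle ℓ) :=
    memLp_one_iff_integrable.1 (memLp_triangle_of_continuousOn (hcr.mul hcM.continuousOn))
  have hiN : IntegrableOn (fun p : ℝ × ℝ => (f p.1)⁻¹ * rightPrimitive κ c p.1 ((p.1 + p.2) / 2))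
      (triangle ℓ) :=
    memLp_one_iff_integrable.1 (memLp_triangle_of_continuousOn (hcr.mul hcN.continuousOn))
  have hbd {t x : ℝ} (hp : ((x, t) : ℝ × ℝ) ∈ triangle ℓ) : |x| ≤ ℓ ∧ |t| ≤ ℓ := by
    rw [abs_of_pos hp.1]
    exact ⟨hp.2.1.le, hp.2.2.le.trans hp.2.1.le⟩
  -- Derivatives in the direction `t`.
  have hMt : IsWeakDirDeriv (triangle ℓ) (0, 1)
      (fun p => (f p.1)⁻¹ * leftPrimitive a p.1 ((p.1 - p.2) / 2))
      (fun p => (f p.1)⁻¹ * a p.1 ((p.1 - p.2) / 2)) :=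
    IsWeakDirDeriv.of_lines (S := id) (MeasurePreserving.id _) continuous_id
      Function.injective_id (fun c x => by simp) (fun c x hp => (hbd hp).2) hiM
      (hrA.integrable (by norm_num)) fun x t₀ t₁ _ _ _ =>
        (h.isPrimitiveOn_leftPrimitive_slice x t₀ t₁).const_mul (f x)⁻¹
  have hNt : IsWeakDirDeriv (triangle ℓ) (0, 1)
      (fun p => (f p.1)⁻¹ * rightPrimitive κ c p.1 ((p.1 + p.2) / 2))
      (fun p => (f p.1)⁻¹ * goursatRight κ c p.1 ((p.1 + p.2) / 2)) :=
    IsWeakDirDeriv.of_lines (S := id) (MeasurePreserving.id _) continuous_id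
      Function.injective_id (fun c x => by simp) (fun c x hp => (hbd hp).2) hiN
      (hrB.integrable (by norm_num)) fun x t₀ t₁ _ _ _ =>
        (h.isPrimitiveOn_rightPrimitive_slice hκ1 x t₀ t₁).const_mul (f x)⁻¹
  -- Derivatives along the characteristics.
  have hMx : IsWeakDirDeriv (triangle ℓ) (1, 1)
      (fun p => (f p.1)⁻¹ * leftPrimitive a p.1 ((p.1 - p.2) / 2))
      (fun p => κ p.1 * ((f p.1)⁻¹ * (rightPrimitive κ c p.1 ((p.1 + p.2) / 2) -
        leftPrimitive a p.1 ((p.1 - p.2) / 2)))) := by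
    refine IsWeakDirDeriv.of_lines (S := fun q => (q.2, q.2 - q.1))
      (measurePreserving_prod_sub_left.comp Measure.measurePreserving_swap) (by fun_prop)
      (fun q q' hq => ?_) (fun c x => ?_) (fun c x hp => (hbd hp).1) hiM
      (hiκ (hcN.sub hcM)) fun d x₀ x₁ h01 h0 h1 => ?_
    · simp only [Prod.mk.injEq] at hq
      exact Prod.ext (by linarith [hq.1, hq.2]) hq.1
    · simp; ring
    · have hd := abs_lt.1 h0.2.2
      simp only at hd
      have e1 (x : ℝ) : (x - (x - d)) / 2 = d / 2 := by ring
      have e2 (x : ℝ) : (x + (x - d)) / 2 = x - d / 2 := by ring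
      simp only [e1, e2]
      have i0 : x₀ ∈ Icc 0 ℓ := ⟨h0.1.le, h0.2.1.le⟩
      have i1 : x₁ ∈ Icc 0 ℓ := ⟨h1.1.le, h1.2.1.le⟩
      refine ((hr.mono i0 i1).mul h01 ((h.isPrimitiveOn_leftPrimitive hκ1 (d / 2) ℓ).mono
        ⟨by linarith, i0.2⟩ ⟨by linarith, i1.2⟩)).congr_deriv h01
        (Filter.Eventually.of_forall fun x _ => ?_)
      ring
  have hNx : IsWeakDirDeriv (triangle ℓ) (1, -1)
      (fun p => (f p.1)⁻¹ * rightPrimitive κ c p.1 ((p.1 + p.2) / 2))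
      (fun p => κ p.1 * ((f p.1)⁻¹ * (leftPrimitive a p.1 ((p.1 - p.2) / 2) -
        rightPrimitive κ c p.1 ((p.1 + p.2) / 2)))) := by
    refine IsWeakDirDeriv.of_lines (S := fun q => (q.2, q.1 - q.2))
      ((measurePreserving_prod_sub volume volume).comp Measure.measurePreserving_swap)
      (by fun_prop)
      (fun q q' hq => ?_) (fun c x => ?_) (fun c x hp => (hbd hp).1) hiN
      (hiκ (hcM.sub hcN)) fun d x₀ x₁ h01 h0 h1 => ?_
    · simp only [Prod.mk.injEq] at hq
      exact Prod.ext (by linarith [hq.1, hq.2]) hq.1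
    · simp; ring
    · have hd := abs_lt.1 h0.2.2
      simp only at hd
      have e1 (x : ℝ) : (x - (d - x)) / 2 = x - d / 2 := by ring
      have e2 (x : ℝ) : (x + (d - x)) / 2 = d / 2 := by ring
      simp only [e1, e2]
      have i0 : x₀ ∈ Icc 0 ℓ := ⟨h0.1.le, h0.2.1.le⟩
      have i1 : x₁ ∈ Icc 0 ℓ := ⟨h1.1.le, h1.2.1.le⟩
      refine ((hr.mono i0 i1).mul h01 ((h.isPrimitiveOn_rightPrimitive hκ1 (ξ := d / 2)
        (by linarith) ℓ).mono ⟨by linarith, i0.2⟩ ⟨by linarith, i1.2⟩)).congr_deriv h01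
        (Filter.Eventually.of_forall fun x _ => ?_)
      ring
  have hK : goursatKernel f κ a c = fun p => f 0 * ((f p.1)⁻¹ *
      leftPrimitive a p.1 ((p.1 - p.2) / 2) + (f p.1)⁻¹ *
      rightPrimitive κ c p.1 ((p.1 + p.2) / 2)) := by
    ext p; simp only [goursatKernel]; ring
  constructor
  · have hx1 := hMx.add_direction hMt.neg_direction
    have hx2 := hNx.add_direction hNt
    have d1 : ((1, 1) : ℝ × ℝ) + -(0, 1) = (1, 0) := by simp
    have d2 : ((1, -1) : ℝ × ℝ) + (0, 1) = (1, 0) := by simp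
    rw [d1] at hx1
    rw [d2] at hx2
    have hsum := (hx1.add hx2).const_mul (f 0)
    rw [← hK] at hsum
    have hg : (fun p : ℝ × ℝ => f 0 * ((f p.1)⁻¹ * (goursatRight κ c p.1 ((p.1 + p.2) / 2) -
        a p.1 ((p.1 - p.2) / 2)))) = fun p => f 0 *
        ((f p.1)⁻¹ * goursatRight κ c p.1 ((p.1 + p.2) / 2) -
          (f p.1)⁻¹ * a p.1 ((p.1 - p.2) / 2)) := by
      ext p; ring
    refine ⟨hg ▸ (hrB.sub hrA).const_mul (f 0), fun φ h1 h2 h3 => ?_⟩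
    rw [hsum.integral_eq φ h1 h2 h3]
    congr 2; ext p; ring
  · have hsum := (hMt.add hNt).const_mul (f 0)
    rw [← hK] at hsum
    have hg : (fun p : ℝ × ℝ => f 0 * ((f p.1)⁻¹ * (a p.1 ((p.1 - p.2) / 2) +
        goursatRight κ c p.1 ((p.1 + p.2) / 2)))) = fun p => f 0 *
        ((f p.1)⁻¹ * a p.1 ((p.1 - p.2) / 2) +
          (f p.1)⁻¹ * goursatRight κ c p.1 ((p.1 + p.2) / 2)) := by
      ext p; ring
    rw [hg]
    exact hsum.hasWeakDirDeriv ((hrA.add hrB).const_mul (f 0))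

end IsGoursatPair

/-! ### Uniqueness -/

lemma IsPrimitiveOn.hasDerivWithinAt {a b : ℝ} {u g : ℝ → ℂ} (hu : IsPrimitiveOn a b u g)
    (hg : ContinuousOn g (Icc a b)) {x : ℝ} (hx : x ∈ Ico a b) :
    HasDerivWithinAt u (g x) (Ici x) x := by
  have hab : a ≤ b := hx.1.trans hx.2.le
  set G : ℝ → ℂ := fun y => g (projIcc a b hab y) with hG
  have hGc : Continuous G := hg.comp_continuous (continuous_subtype_val.comp continuous_projIcc)
    fun y => (projIcc a b hab y).2
  have hGg {y : ℝ} (hy : y ∈ Icc a b) : G y = g y := by simp only [hG, projIcc_of_mem hab hy]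
  have hd : HasDerivAt (fun y => u a + ∫ s in a..y, G s) (G x) x :=
    (intervalIntegral.integral_hasDerivAt_right (hGc.intervalIntegrable _ _)
      (hGc.stronglyMeasurableAtFilter _ _) hGc.continuousAt).const_add _
  have hEq {y : ℝ} (hy : y ∈ Icc a b) : u y = u a + ∫ s in a..y, G s := by
    rw [hu.eq_add y hy]
    congr 1
    refine intervalIntegral.integral_congr fun s hs => ?_
    rw [uIcc_of_le hy.1] at hs
    exact (hGg ⟨hs.1, hs.2.trans hy.2⟩).symm
  have hx' : x ∈ Icc a b := Ico_subset_Icc_self hx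
  rw [← hGg hx']
  refine hd.hasDerivWithinAt.congr_of_eventuallyEq ?_ (hEq hx')
  filter_upwards [Icc_mem_nhdsGE hx.2] with y hy using hEq ⟨hx.1.trans hy.1, hy.2⟩

/-- The initial value problem for the impedance equation has at most one solution: `(v, f² v')`
solves a linear first order system with continuous coefficients. -/
lemma IsImpedanceExp.eqOn {ℓ : ℝ} {f v u : ℝ → ℂ} {ρ : ℂ} (hℓ : 0 ≤ ℓ)
    (hf : ContinuousOn f (Icc 0 ℓ)) (hf0 : ∀ x ∈ Icc 0 ℓ, f x ≠ 0)
    (hv : IsImpedanceExp ℓ f ρ v) (hu : IsImpedanceExp ℓ f ρ u) : EqOn v u (Icc 0 ℓ) := by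
  obtain ⟨v₁, v₂, wv, hv1, hv2, hvw, hve, hv0, hv10⟩ := hv
  obtain ⟨u₁, u₂, wu, hu1, hu2, huw, hue, hu0, hu10⟩ := hu
  have pv := hv1.isPrimitiveOn hℓ
  have pu := hu1.isPrimitiveOn hℓ
  have pwv := hvw.isPrimitiveOn hℓ
  have pwu := huw.isPrimitiveOn hℓ
  have cv := pv.continuousOn hℓ
  have cu := pu.continuousOn hℓ
  have cv1 := (hv2.isPrimitiveOn hℓ).continuousOn hℓ
  have cu1 := (hu2.isPrimitiveOn hℓ).continuousOn hℓ
  have hw {w y : ℝ → ℂ} (hy : ∀ᵐ x ∂(volume.restrict (Ioo 0 ℓ)), -(1 / f x ^ 2) * w x = ρ ^ 2 * y x) :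
      ∀ᵐ x, x ∈ Ioc 0 ℓ → w x = -(ρ ^ 2 * (f x ^ 2 * y x)) := by
    rw [restrict_Ioo_eq_restrict_Ioc, ae_restrict_iff' measurableSet_Ioc] at hy
    filter_upwards [hy] with x hx hxm
    have h1 := hx hxm
    have h2 := hf0 x (Ioc_subset_Icc_self hxm)
    field_simp at h1
    linear_combination -h1
  have dY := pv.sub pu
  have dZ := (pwv.congr_deriv hℓ (hw hve)).sub (pwu.congr_deriv hℓ (hw hue))
  set Y : ℝ → ℂ := fun x => v x - u x with hY
  set Z : ℝ → ℂ := fun x => f x ^ 2 * v₁ x - f x ^ 2 * u₁ x with hZ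
  obtain ⟨C₁, hC₁⟩ := isCompact_Icc.exists_bound_of_continuousOn
    (show ContinuousOn (fun x => (f x ^ 2)⁻¹) (Icc 0 ℓ) from
      (hf.pow 2).inv₀ fun x hx => pow_ne_zero 2 (hf0 x hx))
  obtain ⟨C₂, hC₂⟩ := isCompact_Icc.exists_bound_of_continuousOn
    (show ContinuousOn (fun x => ρ ^ 2 * f x ^ 2) (Icc 0 ℓ) by fun_prop)
  have hgron := norm_le_gronwallBound_of_norm_deriv_right_le (δ := 0) (K := max C₁ C₂) (ε := 0)
    (a := 0) (b := ℓ) (f := fun x => (Y x, Z x))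
    (f' := fun x => (v₁ x - u₁ x, -(ρ ^ 2 * (f x ^ 2 * v x)) - -(ρ ^ 2 * (f x ^ 2 * u x))))
    (by fun_prop) (fun x hx => (dY.hasDerivWithinAt (by fun_prop) hx).prodMk
      (dZ.hasDerivWithinAt (by fun_prop) hx)) (by simp [hY, hZ, hv0, hu0, hv10, hu10])
    (fun x hx => by
      have hx' := Ico_subset_Icc_self hx
      have hfx := hf0 x hx'
      have e1 : v₁ x - u₁ x = (f x ^ 2)⁻¹ * Z x := by simp only [hZ]; field_simp
      have e2 : -(ρ ^ 2 * (f x ^ 2 * v x)) - -(ρ ^ 2 * (f x ^ 2 * u x)) =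
        -(ρ ^ 2 * f x ^ 2 * Y x) := by simp only [hY]; ring
      have h1 : 0 ≤ max C₁ C₂ := (norm_nonneg _).trans ((hC₁ x hx').trans (le_max_left _ _))
      rw [e1, e2, add_zero, Prod.norm_def, Prod.norm_def, norm_neg, norm_mul, norm_mul]
      refine max_le ?_ ?_
      · exact mul_le_mul ((hC₁ x hx').trans (le_max_left _ _)) (le_max_right _ _)
          (norm_nonneg _) h1
      · exact mul_le_mul ((hC₂ x hx').trans (le_max_right _ _)) (le_max_left _ _)
          (norm_nonneg _) h1)
  intro x hx
  have h := hgron x hx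
  rw [gronwallBound_ε0, zero_mul, norm_le_zero_iff, Prod.mk_eq_zero] at h
  exact sub_eq_zero.1 h.1

lemma integral_exp_fourier_eq_zero {ℓ : ℝ} (hℓ : 0 < ℓ) {n : ℤ} (hn : n ≠ 0) :
    ∫ t in (-ℓ)..ℓ, Complex.exp (Complex.I * (Real.pi * n / ℓ : ℝ) * t) = 0 := by
  have hc : Complex.I * (Real.pi * n / ℓ : ℝ) ≠ 0 := by
    refine mul_ne_zero Complex.I_ne_zero (Complex.ofReal_ne_zero.2 ?_)
    have : (n : ℝ) ≠ 0 := by exact_mod_cast hn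
    positivity
  rw [integral_exp_mul_complex hc, div_eq_zero_iff]
  left
  rw [sub_eq_zero, Complex.exp_eq_exp_iff_exists_int]
  refine ⟨n, ?_⟩
  have : (ℓ : ℂ) ≠ 0 := by exact_mod_cast hℓ.ne'
  push_cast
  field_simp
  ring

/-- A square integrable function on `(-ℓ, ℓ)` all of whose Fourier coefficients vanish, except
possibly the one of index zero, is constant. -/
lemma exists_ae_eq_const_of_fourier {ℓ : ℝ} (hℓ : 0 < ℓ) {D : ℝ → ℂ}
    (hD : MemLp D 2 (volume.restrict (Ioc (-ℓ) ℓ)))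
    (h : ∀ n : ℤ, n ≠ 0 →
      ∫ t in (-ℓ)..ℓ, D t * Complex.exp (Complex.I * (Real.pi * n / ℓ : ℝ) * t) = 0) :
    ∃ C, ∀ᵐ t ∂(volume.restrict (Ioc (-ℓ) ℓ)), D t = C := by
  have hle : -ℓ ≤ ℓ := by linarith
  have hlt : -ℓ < ℓ := by linarith
  have hDi : IntervalIntegrable D volume (-ℓ) ℓ := by
    rw [intervalIntegrable_iff, uIoc_of_le hle]
    exact hD.integrable (by norm_num)
  set C : ℂ := (∫ t in (-ℓ)..ℓ, D t) / (2 * ℓ) with hC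
  have hℓ' : (ℓ : ℂ) ≠ 0 := by exact_mod_cast hℓ.ne'
  have hDC : MemLp (fun t => D t - C) 2 (volume.restrict (Ioc (-ℓ) ℓ)) := hD.sub (memLp_const C)
  have hcoef (n : ℤ) : fourierCoeffOn hlt (fun t => D t - C) n = 0 := by
    rw [fourierCoeffOn_eq_integral]
    refine smul_eq_zero_of_right _ ?_
    have hexp (t : ℝ) : (fourier (-n) (t : AddCircle (ℓ - -ℓ)) : ℂ) =
        Complex.exp (Complex.I * (Real.pi * (-n : ℤ) / ℓ : ℝ) * t) := by
      rw [fourier_coe_apply]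
      congr 1
      push_cast
      field_simp
      ring
    simp only [hexp, smul_eq_mul]
    rcases eq_or_ne n 0 with rfl | hn
    · simp only [neg_zero, Int.cast_zero, mul_zero, zero_div, Complex.ofReal_zero, zero_mul,
        Complex.exp_zero, one_mul]
      rw [intervalIntegral.integral_sub hDi (by simp), intervalIntegral.integral_const,
        Complex.real_smul, hC]
      push_cast
      field_simp
      ring
    · have hi : IntervalIntegrable (fun t : ℝ => D t * Complex.exp
          (Complex.I * (Real.pi * (-n : ℤ) / ℓ : ℝ) * t)) volume (-ℓ) ℓ :=
        hDi.mul_continuousOn (by fun_prop)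
      have hi2 : IntervalIntegrable (fun t : ℝ => C * Complex.exp
          (Complex.I * (Real.pi * (-n : ℤ) / ℓ : ℝ) * t)) volume (-ℓ) ℓ :=
        (by fun_prop : Continuous _).intervalIntegrable _ _
      simp only [mul_comm (Complex.exp _), sub_mul]
      rw [intervalIntegral.integral_sub hi hi2, h (-n) (neg_ne_zero.2 hn),
        intervalIntegral.integral_const_mul, integral_exp_fourier_eq_zero hℓ (neg_ne_zero.2 hn)]
      simp
  have hP := hasSum_sq_fourierCoeffOn hlt hDC
  simp only [hcoef, norm_zero, ne_eq, OfNat.ofNat_ne_zero, not_false_eq_true, zero_pow] at hP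
  have h0 := hP.unique hasSum_zero
  rw [smul_eq_zero, intervalIntegral.integral_of_le hle] at h0
  have h1 : ∫ t in Ioc (-ℓ) ℓ, ‖D t - C‖ ^ 2 = 0 := h0.resolve_left (by
    rw [inv_eq_zero]; linarith)
  rw [integral_eq_zero_iff_of_nonneg (fun t => by positivity)
    ((memLp_two_iff_integrable_sq_norm hDC.aestronglyMeasurable).1 hDC)] at h1
  refine ⟨C, ?_⟩
  filter_upwards [h1] with t ht
  have : ‖D t - C‖ = 0 := by simpa using ht
  exact sub_eq_zero.1 (norm_eq_zero.1 this)

/-- Impedance kernels are unique: for almost every `x` the difference of two of them, extended by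
zero to `-ℓ < t < ℓ`, has vanishing Fourier coefficients of nonzero index. So it is constant, and
the constant is zero because the extension vanishes for `x < t < ℓ`. -/
theorem IsImpedanceKernel.ae_eq {ℓ : ℝ} (hℓ : 0 < ℓ) {f : ℝ → ℂ}
    (hf : ContinuousOn f (Icc 0 ℓ)) (hf0 : ∀ x ∈ Icc 0 ℓ, f x ≠ 0) {K L : ℝ × ℝ → ℂ}
    (hK : IsImpedanceKernel ℓ f K) (hL : IsImpedanceKernel ℓ f L) :
    L =ᵐ[volume.restrict (triangle ℓ)] K := by
  have hT := measurableSet_triangle ℓ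
  -- `D` is the difference, extended by zero.
  set D : ℝ × ℝ → ℂ := (triangle ℓ).indicator fun p => L p - K p with hDdef
  have hD : MemLp D 2 := (memLp_indicator_iff_restrict hT).2 (hL.1.sub hK.1)
  have hD2 : Integrable fun p => ‖D p‖ ^ 2 :=
    (memLp_two_iff_integrable_sq_norm hD.aestronglyMeasurable).1 hD
  have hslice (F : ℝ × ℝ → ℂ) (hF : MemLp F 2) : ∀ᵐ x : ℝ, MemLp (fun t => F (x, t)) 2 := by
    have h2 := (memLp_two_iff_integrable_sq_norm hF.aestronglyMeasurable).1 hF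
    have hm : AEStronglyMeasurable F ((volume : Measure ℝ).prod volume) := hF.aestronglyMeasurable
    rw [Measure.volume_eq_prod] at h2
    filter_upwards [hm.prodMk_left, h2.prod_right_ae] with x h1 h3
    exact (memLp_two_iff_integrable_sq_norm h1).2 h3
  have hint (F : ℝ × ℝ → ℂ) (hF : MemLp F 2 (volume.restrict (triangle ℓ))) :
      ∀ᵐ x : ℝ, x ∈ Ioo 0 ℓ → IntervalIntegrable (fun t => F (x, t)) volume (-x) x := by
    filter_upwards [hslice _ ((memLp_indicator_iff_restrict hT).2 hF)] with x hx hxm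
    rw [intervalIntegrable_iff_integrableOn_Ioo_of_le (by linarith [hxm.1])]
    have h1 : IntegrableOn (fun t => (triangle ℓ).indicator F (x, t)) (Ioo (-x) x) :=
      (hx.restrict _).integrable (by norm_num)
    refine h1.congr_fun (fun t ht => ?_) measurableSet_Ioo
    exact indicator_of_mem (show (x, t) ∈ triangle ℓ from ⟨hxm.1, hxm.2, abs_lt.2 ht⟩) F
  have hcoef : ∀ᵐ x : ℝ, x ∈ Ioo 0 ℓ → ∀ n : ℤ, n ≠ 0 →
      ∫ t in (-x)..x, K (x, t) * Complex.exp (Complex.I * (Real.pi * n / ℓ : ℝ) * t) =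
      ∫ t in (-x)..x, L (x, t) * Complex.exp (Complex.I * (Real.pi * n / ℓ : ℝ) * t) := by
    have : ∀ᵐ x : ℝ, ∀ n : ℤ, x ∈ Ioo 0 ℓ → n ≠ 0 →
        ∫ t in (-x)..x, K (x, t) * Complex.exp (Complex.I * (Real.pi * n / ℓ : ℝ) * t) =
        ∫ t in (-x)..x, L (x, t) * Complex.exp (Complex.I * (Real.pi * n / ℓ : ℝ) * t) := by
      refine ae_all_iff.2 fun n => ?_
      obtain ⟨v, hv, hvK⟩ := hK.2 (Real.pi * n / ℓ : ℝ)
      obtain ⟨u, hu, huL⟩ := hL.2 (Real.pi * n / ℓ : ℝ)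
      rw [ae_restrict_iff' measurableSet_Ioo] at hvK huL
      filter_upwards [hvK, huL] with x h1 h2 hx hn
      have h3 := hv.eqOn hℓ.le hf hf0 hu (Ioo_subset_Icc_self hx)
      rw [h1 hx, h2 hx] at h3
      have hn' : (n : ℝ) ≠ 0 := by exact_mod_cast hn
      have hρ : Complex.I * ((Real.pi * n / ℓ : ℝ) : ℂ) ≠ 0 :=
        mul_ne_zero Complex.I_ne_zero (Complex.ofReal_ne_zero.2 (by positivity))
      exact mul_left_cancel₀ hρ (sub_right_injective h3)
    filter_upwards [this] with x hx hxm n hn using hx n hxm hn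
  have hzero : ∀ᵐ x : ℝ, ∀ᵐ t : ℝ, D (x, t) = 0 := by
    filter_upwards [hslice D hD, hint K hK.1, hint L hL.1, hcoef] with x h1 hKi hLi h2
    by_cases hx : x ∈ Ioo 0 ℓ
    swap
    · refine Filter.Eventually.of_forall fun t => ?_
      rw [hDdef, indicator_of_notMem]
      exact fun hm => hx ⟨hm.1, hm.2.1⟩
    have hout (t : ℝ) (ht : t ∉ Ioo (-x) x) : D (x, t) = 0 := by
      rw [hDdef, indicator_of_notMem]
      exact fun hm => ht (abs_lt.1 hm.2.2)
    have hin (t : ℝ) (ht : t ∈ Ioo (-x) x) : D (x, t) = L (x, t) - K (x, t) :=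
      indicator_of_mem (show (x, t) ∈ triangle ℓ from ⟨hx.1, hx.2, abs_lt.2 ht⟩) _
    have hxx : -x ≤ x := by linarith [hx.1]
    obtain ⟨C, hC⟩ := exists_ae_eq_const_of_fourier hℓ (h1.restrict (Ioc (-ℓ) ℓ)) fun n hn => by
      have hexp : ContinuousOn (fun t : ℝ =>
          Complex.exp (Complex.I * (Real.pi * n / ℓ : ℝ) * t)) (uIcc (-x) x) := by fun_prop
      calc ∫ t in (-ℓ)..ℓ, D (x, t) * Complex.exp (Complex.I * (Real.pi * n / ℓ : ℝ) * t)
          = ∫ t in Ioo (-x) x,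
              D (x, t) * Complex.exp (Complex.I * (Real.pi * n / ℓ : ℝ) * t) := by
            rw [intervalIntegral.integral_of_le (by linarith)]
            refine setIntegral_eq_of_subset_of_forall_sdiff_eq_zero measurableSet_Ioc
              (fun t ht => ⟨by linarith [ht.1, hx.2], by linarith [ht.2, hx.2]⟩) fun t ht => ?_
            rw [hout t ht.2, zero_mul]
        _ = ∫ t in Ioo (-x) x, (L (x, t) * Complex.exp (Complex.I * (Real.pi * n / ℓ : ℝ) * t) -
              K (x, t) * Complex.exp (Complex.I * (Real.pi * n / ℓ : ℝ) * t)) := by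
            refine setIntegral_congr_fun measurableSet_Ioo fun t ht => ?_
            simp only [hin t ht, sub_mul]
        _ = 0 := by
            rw [← integral_Ioc_eq_integral_Ioo, ← intervalIntegral.integral_of_le hxx,
              intervalIntegral.integral_sub ((hLi hx).mul_continuousOn hexp)
                ((hKi hx).mul_continuousOn hexp), h2 hx n hn, sub_self]
    have hC0 : C = 0 := by
      have hCx : ∀ᵐ t ∂(volume.restrict (Ioc x ℓ)), D (x, t) = C :=
        ae_restrict_of_ae_restrict_of_subset (Ioc_subset_Ioc_left (by linarith [hx.1, hx.2])) hC
      have : (ae (volume.restrict (Ioc x ℓ))).NeBot := by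
        rw [ae_neBot]
        simpa [Measure.restrict_eq_zero] using hx.2
      obtain ⟨t, ht, htm⟩ := (hCx.and (ae_restrict_mem measurableSet_Ioc)).exists
      rw [← ht, hout t fun h => (not_lt.2 h.2.le) htm.1]
    rw [ae_restrict_iff' measurableSet_Ioc] at hC
    filter_upwards [hC] with t ht
    by_cases htm : t ∈ Ioc (-ℓ) ℓ
    · rw [ht htm, hC0]
    · exact hout t fun h => htm ⟨by linarith [h.1, hx.2], by linarith [h.2, hx.2]⟩
  have hDint : ∫ p, ‖D p‖ ^ 2 = 0 := by
    rw [Measure.volume_eq_prod] at hD2 ⊢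
    rw [integral_prod _ hD2]
    refine integral_eq_zero_of_ae ?_
    filter_upwards [hzero] with x hx
    refine integral_eq_zero_of_ae ?_
    filter_upwards [hx] with t ht
    simp [ht]
  rw [integral_eq_zero_iff_of_nonneg (fun p => by positivity) hD2] at hDint
  refine (ae_restrict_iff' hT).2 ?_
  filter_upwards [hDint] with p hp hpm
  have h1 : ‖D p‖ = 0 := by simpa using hp
  rw [norm_eq_zero, hDdef, indicator_of_mem hpm] at h1
  exact sub_eq_zero.1 h1

/-! ### The impedance kernel -/

/-- The logarithmic derivative of a nonvanishing Sobolev function, extended by zero. -/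
lemma exists_logDeriv {ℓ : ℝ} (hℓ : 0 ≤ ℓ) {f : ℝ → ℂ} (hf : MemSobolevInterval ℓ f)
    (hf0 : ∀ x ∈ Icc 0 ℓ, f x ≠ 0) :
    ∃ κ : ℝ → ℂ, MemLp κ 2 ∧ Integrable κ ∧ (∀ s ≤ 0, κ s = 0) ∧
      IsPrimitiveOn 0 ℓ f fun x => κ x * f x := by
  obtain ⟨g, hg⟩ := hf
  have hp := hg.isPrimitiveOn hℓ
  have hci : ContinuousOn (fun x => (f x)⁻¹) (Icc 0 ℓ) := (hp.continuousOn hℓ).inv₀ hf0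
  have hm : MemLp (fun x => g x * (f x)⁻¹) 2 (volume.restrict (Ioo 0 ℓ)) := by
    obtain ⟨C, hC⟩ := isCompact_Icc.exists_bound_of_continuousOn hci
    refine hg.1.of_le_mul (c := C) (hg.1.aestronglyMeasurable.mul
      ((hci.mono Ioo_subset_Icc_self).aestronglyMeasurable measurableSet_Ioo)) ?_
    refine (ae_restrict_iff' measurableSet_Ioo).2 (Filter.Eventually.of_forall fun x hx => ?_)
    rw [norm_mul, mul_comm]
    gcongr
    exact hC x (Ioo_subset_Icc_self hx)
  refine ⟨(Ioo 0 ℓ).indicator fun x => g x * (f x)⁻¹,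
    (memLp_indicator_iff_restrict measurableSet_Ioo).2 hm,
    (integrable_indicator_iff measurableSet_Ioo).2 (hm.integrable (by norm_num)),
    fun s hs => indicator_of_notMem (fun h => not_lt.2 hs h.1) _, hp.congr_deriv hℓ ?_⟩
  have h₁ : ∀ᵐ x : ℝ, x ≠ ℓ := by simp [ae_iff, measure_singleton]
  filter_upwards [h₁] with x hx hxm
  rw [indicator_of_mem (show x ∈ Ioo 0 ℓ from ⟨hxm.1, lt_of_le_of_ne hxm.2 hx⟩)]
  have := hf0 x (Ioc_subset_Icc_self hxm)
  field_simp

lemma HasWeakDirDeriv.congr_ae {Ω : Set (ℝ × ℝ)} {e : ℝ × ℝ} {u v g : ℝ × ℝ → ℂ}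
    (h : HasWeakDirDeriv Ω e u g) (huv : v =ᵐ[volume.restrict Ω] u) :
    HasWeakDirDeriv Ω e v g := by
  refine ⟨h.1, fun φ h1 h2 h3 => ?_⟩
  rw [← h.2 φ h1 h2 h3]
  refine integral_congr_ae ?_
  filter_upwards [huv] with p hp
  rw [hp]

end Impedance

end

theorem mainTheorem10 (ℓ : ℝ) (hℓ : 0 < ℓ) (f : ℝ → ℂ)
    (hf : Impedance.MemSobolevInterval ℓ f) (hf0 : ∀ x ∈ Icc 0 ℓ, f x ≠ 0) :
    -- the kernel of `f` exists and is unique up to null sets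
    (∃ K, Impedance.IsImpedanceKernel ℓ f K ∧
      ∀ L, Impedance.IsImpedanceKernel ℓ f L →
        L =ᵐ[volume.restrict (Impedance.triangle ℓ)] K) ∧
    -- it is continuous on the closed triangle and belongs to the Sobolev space
    (∀ K, Impedance.IsImpedanceKernel ℓ f K →
      (∃ K₀ : ℝ × ℝ → ℂ, ContinuousOn K₀ (Impedance.closedTriangle ℓ) ∧
        K =ᵐ[volume.restrict (Impedance.triangle ℓ)] K₀) ∧
      Impedance.MemSobolevPlane (Impedance.triangle ℓ) K) ∧
    -- for a normalized impedance, the kernels of `f` and `1 / f` are related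
    (f 0 = 1 → ∀ K L, Impedance.IsImpedanceKernel ℓ f K →
      Impedance.IsImpedanceKernel ℓ (fun x => 1 / f x) L →
      ∃ Kx Kt Lx Lt : ℝ × ℝ → ℂ,
        Impedance.HasWeakDerivX (Impedance.triangle ℓ) K Kx ∧
        Impedance.HasWeakDerivT (Impedance.triangle ℓ) K Kt ∧
        Impedance.HasWeakDerivX (Impedance.triangle ℓ) L Lx ∧
        Impedance.HasWeakDerivT (Impedance.triangle ℓ) L Lt ∧
        (∀ᵐ p ∂(volume.restrict (Impedance.triangle ℓ)), Lx p = -(f p.1 ^ 2) * Kt p) ∧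
        (∀ᵐ p ∂(volume.restrict (Impedance.triangle ℓ)),
          Kx p = -(1 / f p.1 ^ 2) * Lt p)) := by
  open Impedance in
  obtain ⟨κ, hκ, hκ1, hκ0, hfp⟩ := exists_logDeriv hℓ.le hf hf0
  obtain ⟨a, c, hac⟩ := exists_isGoursatPair hκ hκ1 hκ0
  have hK := hac.isImpedanceKernel hκ hκ1 hℓ.le hfp hf0
  have hfc := hfp.continuousOn hℓ.le
  have huniq {K : ℝ × ℝ → ℂ} (h : IsImpedanceKernel ℓ f K) :
      K =ᵐ[volume.restrict (triangle ℓ)] goursatKernel f κ a c :=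
    hK.ae_eq hℓ hfc hf0 h
  obtain ⟨hKx, hKt⟩ := hac.hasWeakDeriv_goursatKernel hκ hκ1 hℓ.le hfp hf0
  refine ⟨⟨_, hK, fun L hL => huniq hL⟩, fun K h => ⟨⟨_, hac.continuousOn_goursatKernel hκ1 hℓ.le
    hfp hf0, huniq h⟩, h.1, ⟨_, hKx.congr_ae (huniq h)⟩, ⟨_, hKt.congr_ae (huniq h)⟩⟩,
    fun hf1 K L h h' => ?_⟩
  -- Passing from `f` to `1 / f` changes the sign of the logarithmic derivative.
  have hrp : IsPrimitiveOn 0 ℓ (fun x => 1 / f x) fun x => -κ x * (1 / f x) := by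
    simpa only [one_div] using isPrimitiveOn_inv hℓ.le hfp hf0
  have hr0 : ∀ x ∈ Icc 0 ℓ, 1 / f x ≠ 0 := fun x hx => one_div_ne_zero (hf0 x hx)
  have hLu := (hac.neg.isImpedanceKernel hκ.neg hκ1.neg hℓ.le hrp hr0).ae_eq hℓ
    (hrp.continuousOn hℓ.le) hr0 h'
  obtain ⟨hLx, hLt⟩ := hac.neg.hasWeakDeriv_goursatKernel hκ.neg hκ1.neg hℓ.le hrp hr0
  refine ⟨_, _, _, _, hKx.congr_ae (huniq h), hKt.congr_ae (huniq h), hLx.congr_ae hLu,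
    hLt.congr_ae hLu, ?_, ?_⟩
  all_goals
    refine (ae_restrict_iff' (measurableSet_triangle ℓ)).2
      (Filter.Eventually.of_forall fun p hp => ?_)
    have hfx := hf0 p.1 ⟨hp.1.le, hp.2.1.le⟩
    simp only [hf1, goursatRight, one_div, inv_inv, inv_one]
    field_simp
    ring
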